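/- Let $X$ be a real random variable with $\mathbb E[e^{X}]=1$ (a risk-neutral log-return) and distribution function $F(x)=\mathbb P[X\le x]$; if $X$ has a density, write $f$ for (any Borel version of) it. For $k\in\mathbb R$ let $$c(k)=\int_k^\infty (e^x-e^k)\,dF(x),\qquad p(k)=\int_{-\infty}^k (e^k-e^x)\,dF(x)$$ be the normalized call and put prices with log-strike $k$. With $\Phi$ the standard normal distribution function and $\sigma>0$, let $c_{BS}(k,\sigma)=\Phi(-k/\sigma+\sigma/2)-e^k\,\Phi(-k/\sigma-\sigma/2)$, and let the implied volatility $V(k)$ be the unique $\sigma>0$ with $c_{BS}(k,\sigma)=c(k)$ ($V(k)=0$ if $c(k)=(1-e^k)^+$, the limiting case). Put $\psi[x]=2-4\left[\sqrt{x^2+x}-x\right]$ for $x\ge 0$. Write $g\in R_\alpha$ if $g$ is real-valued, positive and measurable on some half-line $[a,\infty)$ and $g(\lambda x)/g(x)\to\lambda^\alpha$ as $x\to\infty$ for every $\lambda>0$. Write $g(k)\sim h(k)$ if $g(k)/h(k)\to1$ as $k\to\infty$. **Theorem (Left-tail-wing formula).** Assume $\alpha>0$ and $\mathbb E[e^{-\epsilon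 X}]<\infty$ for some $\epsilon>0$. Consider the conditions (as functions of $k\to\infty$) (i) $X$ has a density $f$ and $-\log f(-k)\in R_\alpha$; (ii) $-\log F(-k)\in R_\alpha$; (iii) $-\log p(-k)\in R_\alpha$; (iv) $V(-k)^2/k\sim\psi\left[-1-\log p(-k)/k\right]$. Then (i) $\Rightarrow$ (ii) $\Rightarrow$ (iii) $\Rightarrow$ (iv). Moreover: * If (ii) holds, then $-\log p(-k)\sim k-\log F(-k)$ and $V(-k)^2/k\sim\psi\left[-\log F(-k)/k\right]$. * If (i) holds, then $-\log f(-k)\sim-\log F(-k)$ and $V(-k)^2/k\sim\psi\left[-\log f(-k)/k\right]$. * If one of $-\log f(-k)/k$ (when a density exists), $-\log F(-k)/k$, $-\log p(-k)/k$ tends to infinity as $k\to\infty$, then $V(-k)^2/k\to0$. More precisely, if $-\log p(-k)/k\to\infty$, then $$V(-k)^2/k\sim\frac{1}{-2\log p(-k)/k};$$ if (ii) holds and $-\log F(-k)/k\to\infty$ or $-\log p(-k)/k\to\infty$, then this holds and also $$V(-k)^2/k\sim\frac{1}{-2\log F(-k)/k};$$ if (i) holds and any one of the three quotients tends to infinity,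 then both of these hold and also $$V(-k)^2/k\sim\frac{1}{-2\log f(-k)/k}.$$ -/

import Mathlib

open MeasureTheory ProbabilityTheory Filter Topology Set

noncomputable section

/-- `g ∼ h` as `k → ∞`: the quotient `g k / h k` tends to `1`. -/
def AsympEq (g h : ℝ → ℝ) : Prop :=
  Tendsto (fun k => g k / h k) atTop (𝓝 1)

/-- `g ∈ R_α`: on some half-line `[a, ∞)` the function `g` is positive and (Borel) measurable, and
`g (l x) / g x → l ^ α` as `x → ∞` for every `l > 0`. -/
structure RegVarying (α : ℝ) (g : ℝ → ℝ) : Prop where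
  pos_measurable : ∃ a : ℝ, (∀ x, a ≤ x → 0 < g x) ∧ Measurable (fun x : Ici a => g x)
  tendsto_ratio : ∀ l : ℝ, 0 < l → Tendsto (fun x => g (l * x) / g x) atTop (𝓝 (l ^ α))

/-- The distribution function of the standard normal law. -/
def stdNormalCdf (x : ℝ) : ℝ := cdf (gaussianReal 0 1) x

/-- Normalized Black-Scholes call price with log-strike `k` and total volatility `σ > 0`. -/
def callBS (k σ : ℝ) : ℝ :=
  stdNormalCdf (-k / σ + σ / 2) - Real.exp k * stdNormalCdf (-k / σ - σ / 2)

/-- The function `ψ`. -/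
def wingPsi (x : ℝ) : ℝ := 2 - 4 * (√(x ^ 2 + x) - x)

section Market

variable {Ω : Type*} [MeasurableSpace Ω] (P : Measure Ω) (X : Ω → ℝ)

/-- The cumulative distribution function `F` of `X`. -/
def distFn (x : ℝ) : ℝ := cdf (P.map X) x

/-- `f` is a (Borel, nonnegative) probability density function of `X`. -/
structure IsDensity (f : ℝ → ℝ) : Prop where
  measurable : Measurable f
  nonneg : ∀ x, 0 ≤ f x
  map_eq : P.map X = volume.withDensity (fun x => ENNReal.ofReal (f x))

/-- Normalized call price with log-strike `k`: `∫_k^∞ (e^x - e^k) dF(x)`. -/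
def callPrice (k : ℝ) : ℝ := ∫ x in Ioi k, (Real.exp x - Real.exp k) ∂(P.map X)

/-- Normalized put price with log-strike `k`: `∫_{-∞}^k (e^k - e^x) dF(x)`. -/
def putPrice (k : ℝ) : ℝ := ∫ x in Iio k, (Real.exp k - Real.exp x) ∂(P.map X)

open Classical in
/-- Implied volatility `V(k)`: the (unique) `σ > 0` with `callBS k σ = callPrice k`. If there is no
such `σ`, then `V(k) = 0`; for risk-neutral `X` this happens exactly when the call price is the
intrinsic value `(1 - e^k)^+`, the limit of `callBS k σ` as `σ → 0`. -/
def impliedVol (k : ℝ) : ℝ :=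
  if h : ∃ σ : ℝ, 0 < σ ∧ callBS k σ = callPrice P X k then h.choose else 0

end Market

end

/-! ### The standard normal distribution function -/

/-! Put-call parity and the symmetry `callBS_neg` turn the implied volatility at `-k` into a
solution of `callBS k σ = e^{-kx}`, where `x = -1 - log p(-k) / k`. At `σ² = s k` the exponential
rate of the Black-Scholes price is `bsRate s = (2 - s)² / (8 s)`, and `ψ` inverts this rate with
values in `(0, 2]`. A Chernoff bound gives `σ² / k ≥ ψ(x)` for every `k > 0`. Integrating the vega
over a short range of volatilities gives `σ² / k ≤ (1 + δ) ψ(x)` for large `k`, uniformly in `x ≥ ε`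
(`eventually_callBS_vol_le`). The negative exponential moment provides this `ε`. Hence the formula
in terms of `p` needs only that `p(-k)` is eventually positive.

Regular variation serves to pass between `f`, `F` and `p`. For `f` and `F`, a tail integral of `exp
(-g)` has logarithm asymptotic to `-g` when `g` varies regularly with positive index. For `F` and
`p`, the sandwich `e^{-k} (1 - e^{-1}) F(-k-1) ≤ p(-k) ≤ e^{-k} F(-k)` suffices, since a unit shift
hardly changes `-log F`. Both rest on the uniform convergence theorem
(`RegVarying.eventually_bounds`). Equivalent arguments of `ψ` give equivalent values because `ψ`
decreases while `x ψ(x)` increases, and `2 x ψ(x) → 1` yields the statements for infinite rates. -/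

lemma stdNormalCdf_eq_real (x : ℝ) : stdNormalCdf x = (gaussianReal 0 1).real (Iic x) :=
  cdf_eq_real _ x

lemma stdNormalCdf_nonneg (x : ℝ) : 0 ≤ stdNormalCdf x := cdf_nonneg _ x

lemma stdNormalCdf_eq_integral (x : ℝ) :
    stdNormalCdf x = ∫ t in Iic x, gaussianPDFReal 0 1 t := by
  rw [stdNormalCdf_eq_real, measureReal_def, gaussianReal_apply_eq_integral 0 one_ne_zero,
    ENNReal.toReal_ofReal]
  exact setIntegral_nonneg measurableSet_Iic fun t _ => gaussianPDFReal_nonneg 0 1 t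

lemma continuous_gaussianPDFReal_std : Continuous (gaussianPDFReal 0 1) := by
  unfold gaussianPDFReal
  fun_prop

lemma hasDerivAt_stdNormalCdf (x : ℝ) :
    HasDerivAt stdNormalCdf (gaussianPDFReal 0 1 x) x := by
  have hi : ∀ y, IntegrableOn (gaussianPDFReal 0 1) (Iic y) := fun y =>
    (integrable_gaussianPDFReal 0 1).integrableOn
  have h := (continuous_gaussianPDFReal_std.integral_hasStrictDerivAt 0 x).hasDerivAt
  have he : stdNormalCdf = fun u => stdNormalCdf 0 + ∫ t in (0 : ℝ)..u, gaussianPDFReal 0 1 t := by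
    funext u
    rw [← intervalIntegral.integral_Iic_sub_Iic (hi 0) (hi u), stdNormalCdf_eq_integral,
      stdNormalCdf_eq_integral]
    ring
  rw [he]
  exact h.const_add _

lemma stdNormalCdf_neg (x : ℝ) : stdNormalCdf (-x) = 1 - stdNormalCdf x := by
  have := nullSingletonClass_gaussianReal (μ := 0) (v := 1) one_ne_zero
  have h1 : (gaussianReal 0 1).real (Iic (-x)) = (gaussianReal 0 1).real (Ici x) := by
    conv_lhs => rw [← neg_zero, ← gaussianReal_map_neg]
    rw [measureReal_def, Measure.map_apply measurable_neg measurableSet_Iic, measureReal_def]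
    congr 2
    ext y
    simp
  rw [stdNormalCdf_eq_real, stdNormalCdf_eq_real, h1, ← probReal_compl_eq_one_sub measurableSet_Iic,
    compl_Iic, measureReal_def, measureReal_def, measure_congr Ioi_ae_eq_Ici]

/-- Chernoff's bound at the optimal tilt `t = x`. The prefactor is 1, so the lower bound on the
volatility loses nothing. -/
lemma stdNormalCdf_le_exp {x : ℝ} (hx : x ≤ 0) :
    stdNormalCdf x ≤ Real.exp (-(x ^ 2 / 2)) := by
  rw [stdNormalCdf_eq_real]
  have h := measure_le_le_exp_mul_mgf (μ := gaussianReal 0 1) (X := id) (t := x) x hx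
    (integrable_exp_mul_gaussianReal x)
  rw [mgf_id_gaussianReal] at h
  refine (h.trans_eq ?_)
  rw [← Real.exp_add]
  congr 1
  simp
  ring

lemma tendsto_stdNormalCdf_atBot : Tendsto stdNormalCdf atBot (𝓝 0) := tendsto_cdf_atBot _

lemma tendsto_stdNormalCdf_atTop : Tendsto stdNormalCdf atTop (𝓝 1) := tendsto_cdf_atTop _

lemma gaussianPDFReal_std (x : ℝ) :
    gaussianPDFReal 0 1 x = (√(2 * Real.pi))⁻¹ * Real.exp (-(x ^ 2 / 2)) := by
  simp [gaussianPDFReal, neg_div]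

/-! ### The Black-Scholes price as a function of the volatility -/

/-- The squares of the two arguments differ by `-2k`; this makes the two terms of the vega collapse
into one. -/
lemma exp_mul_gaussianPDFReal (k : ℝ) {σ : ℝ} (hσ : σ ≠ 0) :
    Real.exp k * gaussianPDFReal 0 1 (-k / σ - σ / 2) =
      gaussianPDFReal 0 1 (-k / σ + σ / 2) := by
  rw [gaussianPDFReal_std, gaussianPDFReal_std, mul_left_comm, ← Real.exp_add]
  congr 2
  field_simp
  ring

/-- The vega of the Black-Scholes price. -/
lemma hasDerivAt_callBS (k : ℝ) {σ : ℝ} (hσ : σ ≠ 0) :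
    HasDerivAt (callBS k) (gaussianPDFReal 0 1 (-k / σ + σ / 2)) σ := by
  have h0 : HasDerivAt (fun s : ℝ => -k / s) (k / σ ^ 2) σ := by
    have := (hasDerivAt_inv hσ).const_mul (-k)
    refine (this.congr_deriv ?_)
    field_simp
  have h2 : HasDerivAt (fun s : ℝ => s / 2) (1 / 2) σ := (hasDerivAt_id σ).div_const 2
  have ha := (hasDerivAt_stdNormalCdf (-k / σ + σ / 2)).comp σ (h0.add h2)
  have hb := (hasDerivAt_stdNormalCdf (-k / σ - σ / 2)).comp σ (h0.sub h2)
  refine (ha.sub (hb.const_mul (Real.exp k))).congr_deriv ?_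
  rw [← mul_assoc, exp_mul_gaussianPDFReal k hσ]
  ring

lemma continuousOn_callBS (k : ℝ) : ContinuousOn (callBS k) (Ioi 0) := fun _ hσ =>
  (hasDerivAt_callBS k (ne_of_gt hσ)).continuousAt.continuousWithinAt

lemma monotoneOn_callBS (k : ℝ) : MonotoneOn (callBS k) (Ioi 0) := by
  refine monotoneOn_of_deriv_nonneg (convex_Ioi 0) (continuousOn_callBS k) ?_ ?_
  · rw [interior_Ioi]
    exact fun σ hσ => (hasDerivAt_callBS k (ne_of_gt hσ)).differentiableAt.differentiableWithinAt
  · rw [interior_Ioi]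
    intro σ hσ
    rw [(hasDerivAt_callBS k (ne_of_gt hσ)).deriv]
    exact gaussianPDFReal_nonneg _ _ _

lemma tendsto_callBS_zero {k : ℝ} (hk : 0 < k) : Tendsto (callBS k) (𝓝[>] 0) (𝓝 0) := by
  have h1 : Tendsto (fun s : ℝ => -k / s) (𝓝[>] 0) atBot := by
    simp only [div_eq_mul_inv]
    exact tendsto_inv_nhdsGT_zero.const_mul_atTop_of_neg (neg_lt_zero.2 hk)
  have h2 : Tendsto (fun s : ℝ => s / 2) (𝓝[>] 0) (𝓝 0) := by
    have : Tendsto (fun s : ℝ => s / 2) (𝓝 0) (𝓝 (0 / 2)) := tendsto_id.div_const 2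
    rw [zero_div] at this
    exact this.mono_left nhdsWithin_le_nhds
  have ha := tendsto_stdNormalCdf_atBot.comp (h1.atBot_add h2)
  have hb := tendsto_stdNormalCdf_atBot.comp (h1.atBot_add h2.neg)
  have := ha.sub (hb.const_mul (Real.exp k))
  simp only [mul_zero, sub_zero] at this
  refine this.congr fun s => ?_
  simp [callBS, sub_eq_add_neg]

lemma tendsto_callBS_atTop (k : ℝ) : Tendsto (callBS k) atTop (𝓝 1) := by
  have h1 : Tendsto (fun s : ℝ => -k / s) atTop (𝓝 0) := tendsto_const_nhds.div_atTop tendsto_id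
  have h2 : Tendsto (fun s : ℝ => s / 2) atTop atTop := tendsto_id.atTop_div_const two_pos
  have ha := tendsto_stdNormalCdf_atTop.comp (h1.add_atTop h2)
  have hb := tendsto_stdNormalCdf_atBot.comp (h1.add_atBot (tendsto_neg_atTop_atBot.comp h2))
  have := ha.sub (hb.const_mul (Real.exp k))
  simp only [mul_zero, sub_zero] at this
  refine this.congr fun s => ?_
  simp [callBS, sub_eq_add_neg]

lemma callBS_nonneg {k σ : ℝ} (hk : 0 < k) (hσ : 0 < σ) : 0 ≤ callBS k σ := by
  refine le_of_tendsto (tendsto_callBS_zero hk) ?_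
  filter_upwards [Ioo_mem_nhdsGT hσ] with s hs
  exact monotoneOn_callBS k hs.1 hσ hs.2.le

lemma exists_callBS_eq {k q : ℝ} (hk : 0 < k) (h0 : 0 < q) (h1 : q < 1) :
    ∃ σ : ℝ, 0 < σ ∧ callBS k σ = q := by
  obtain ⟨σ, hσ, h⟩ := isPreconnected_Ioi.intermediate_value_Ioo (l₁ := 𝓝[>] (0 : ℝ)) (l₂ := atTop)
    inf_le_right (le_principal_iff.2 (Ioi_mem_atTop 0)) (continuousOn_callBS k)
    (tendsto_callBS_zero hk) (tendsto_callBS_atTop k) ⟨h0, h1⟩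
  exact ⟨σ, hσ, h⟩

/-- Reflection of the normal law. It moves the problem to a positive log-strike, where the price
tends to 0 with `σ`. -/
lemma callBS_neg (k σ : ℝ) :
    callBS (-k) σ = 1 - Real.exp (-k) + Real.exp (-k) * callBS k σ := by
  have h1 : -(-k) / σ + σ / 2 = -(-k / σ - σ / 2) := by ring
  have h2 : -(-k) / σ - σ / 2 = -(-k / σ + σ / 2) := by ring
  have h3 : Real.exp (-k) * Real.exp k = 1 := by rw [← Real.exp_add]; simp
  unfold callBS
  rw [h1, h2, stdNormalCdf_neg, stdNormalCdf_neg]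
  linear_combination (stdNormalCdf (-k / σ - σ / 2)) * h3

/-! ### The function `ψ` and the exponential rate of the Black-Scholes price -/

/-- The exponential rate of decay of the Black-Scholes price at `σ² = s k`. -/
noncomputable def bsRate (s : ℝ) : ℝ := (2 - s) ^ 2 / (8 * s)

lemma half_sq_bs_arg {k σ : ℝ} (hk : 0 < k) (hσ : 0 < σ) :
    (-k / σ + σ / 2) ^ 2 / 2 = k * bsRate (σ ^ 2 / k) := by
  unfold bsRate
  field_simp
  ring

/-- Multiplication by the conjugate, as `(1 + 2x)² - 4(x² + x) = 1`. The quotient form avoids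
cancellation and shows sign and monotonicity. -/
lemma wingPsi_mul {x : ℝ} (hx : 0 ≤ x) : wingPsi x * (1 + 2 * x + 2 * √(x ^ 2 + x)) = 2 := by
  have h := Real.sq_sqrt (show 0 ≤ x ^ 2 + x by positivity)
  unfold wingPsi
  linear_combination (-8) * h

lemma wingPsi_eq {x : ℝ} (hx : 0 ≤ x) : wingPsi x = 2 / (1 + 2 * x + 2 * √(x ^ 2 + x)) := by
  rw [eq_div_iff (by positivity), wingPsi_mul hx]

lemma wingPsi_pos {x : ℝ} (hx : 0 ≤ x) : 0 < wingPsi x := by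
  rw [wingPsi_eq hx]; positivity

lemma wingPsi_antitone {x y : ℝ} (hx : 0 ≤ x) (hxy : x ≤ y) : wingPsi y ≤ wingPsi x := by
  rw [wingPsi_eq hx, wingPsi_eq (hx.trans hxy)]
  gcongr

lemma wingPsi_lt_two {x : ℝ} (hx : 0 < x) : wingPsi x < 2 := by
  rw [wingPsi_eq hx.le, div_lt_iff₀ (by positivity)]
  have := Real.sqrt_nonneg (x ^ 2 + x)
  linarith

lemma wingPsi_le_two {x : ℝ} (hx : 0 ≤ x) : wingPsi x ≤ 2 := by
  rw [wingPsi_eq hx, div_le_iff₀ (by positivity)]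
  have := Real.sqrt_nonneg (x ^ 2 + x)
  linarith

/-- After division by `x`, the denominator of `x ψ(x)` is `1/x + 2 + 2 √(1 + 1/x)`, which decreases.
-/
lemma mul_wingPsi_le {x y : ℝ} (hx : 0 < x) (hxy : x ≤ y) : x * wingPsi x ≤ y * wingPsi y := by
  have hy : 0 < y := hx.trans_le hxy
  rw [wingPsi_eq hx.le, wingPsi_eq hy.le, mul_div_assoc', mul_div_assoc',
    div_le_div_iff₀ (by positivity) (by positivity)]
  have h : x * √(y ^ 2 + y) ≤ y * √(x ^ 2 + x) := by
    have e1 : x * √(y ^ 2 + y) = √(x ^ 2 * (y ^ 2 + y)) := by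
      rw [Real.sqrt_mul (sq_nonneg x), Real.sqrt_sq hx.le]
    have e2 : y * √(x ^ 2 + x) = √(y ^ 2 * (x ^ 2 + x)) := by
      rw [Real.sqrt_mul (sq_nonneg y), Real.sqrt_sq hy.le]
    rw [e1, e2]
    apply Real.sqrt_le_sqrt
    have := mul_le_mul_of_nonneg_left hxy (mul_pos hx hy).le
    nlinarith
  nlinarith

lemma sqrt_sq_add_self_le {x : ℝ} (hx : 0 ≤ x) : √(x ^ 2 + x) ≤ x + 1 / 2 := by
  rw [Real.sqrt_le_left (by positivity)]
  nlinarith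

lemma inv_wingPsi_le {x : ℝ} (hx : 0 ≤ x) : (wingPsi x)⁻¹ ≤ 1 + 2 * x := by
  rw [wingPsi_eq hx, inv_div, div_le_iff₀ two_pos]
  linarith [sqrt_sq_add_self_le hx]

lemma bsRate_wingPsi {x : ℝ} (hx : 0 ≤ x) : bsRate (wingPsi x) = x := by
  have h := Real.sq_sqrt (show 0 ≤ x ^ 2 + x by positivity)
  unfold bsRate
  rw [div_eq_iff (mul_ne_zero (by norm_num) (wingPsi_pos hx).ne')]
  unfold wingPsi
  linear_combination 16 * h

lemma bsRate_strictAnti {s t : ℝ} (hs : 0 < s) (hst : s < t) (ht : t ≤ 2) :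
    bsRate t < bsRate s := by
  unfold bsRate
  have h : (2 - t) ^ 2 ≤ (2 - s) ^ 2 := pow_le_pow_left₀ (by linarith) (by linarith) 2
  rw [div_lt_div_iff₀ (by linarith) (by linarith)]
  have h1 : (2 - t) ^ 2 * (8 * s) ≤ (2 - s) ^ 2 * (8 * s) := by gcongr
  have h2 : (2 - s) ^ 2 * (8 * s) < (2 - s) ^ 2 * (8 * t) := by
    have : 0 < 2 - s := by linarith
    gcongr
  linarith

lemma bsRate_anti {s t : ℝ} (hs : 0 < s) (hst : s ≤ t) (ht : t ≤ 2) :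
    bsRate t ≤ bsRate s := by
  rcases hst.eq_or_lt with rfl | h
  · exact le_rfl
  · exact (bsRate_strictAnti hs h ht).le

/-- Enlarging `s` shrinks the numerator and multiplies the denominator by `l`: a relative gap in
variance becomes a relative gap in rate. -/
lemma bsRate_mul_le {s l : ℝ} (hs : 0 < s) (hl : 1 ≤ l) (hls : l * s ≤ 2) :
    bsRate (l * s) ≤ bsRate s / l := by
  have h : (2 - l * s) ^ 2 ≤ (2 - s) ^ 2 := by
    have : s ≤ l * s := le_mul_of_one_le_left hs.le hl
    exact pow_le_pow_left₀ (by linarith) (by linarith) 2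
  unfold bsRate
  rw [div_div]
  have e : 8 * s * l = 8 * (l * s) := by ring
  rw [e]
  gcongr

/-- Every volatility matching the price `e^{-kx}` satisfies `σ² / k ≥ ψ(x)`. -/
lemma wingPsi_le_of_callBS_eq {k σ x : ℝ} (hk : 0 < k) (hσ : 0 < σ) (hx : 0 ≤ x)
    (h : callBS k σ = Real.exp (-(k * x))) : wingPsi x ≤ σ ^ 2 / k := by
  by_contra! hlt
  have hs : 0 < σ ^ 2 / k := by positivity
  have h2 := wingPsi_le_two hx
  have hrate : x < bsRate (σ ^ 2 / k) := by
    have := bsRate_strictAnti hs hlt h2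
    rwa [bsRate_wingPsi hx] at this
  have harg : -k / σ + σ / 2 ≤ 0 := by
    have : σ ^ 2 < 2 * k := by
      have := hlt.trans_le h2
      rwa [div_lt_iff₀ hk] at this
    have e : -k / σ + σ / 2 = (σ ^ 2 - 2 * k) / (2 * σ) := by field_simp; ring
    rw [e]
    exact div_nonpos_of_nonpos_of_nonneg (by linarith) (by positivity)
  have h3 : callBS k σ ≤ Real.exp (-(k * bsRate (σ ^ 2 / k))) := by
    rw [← half_sq_bs_arg hk hσ]
    refine le_trans ?_ (stdNormalCdf_le_exp harg)
    have := mul_nonneg (Real.exp_pos k).le (stdNormalCdf_nonneg (-k / σ - σ / 2))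
    unfold callBS
    linarith
  rw [h, Real.exp_le_exp] at h3
  nlinarith

/-- Mean value theorem between the two volatilities. The rate decreases on `(0, 2]`, so the vega is
at least the Gaussian density at the left end; the price there is nonnegative and is dropped. -/
lemma le_callBS {k s t : ℝ} (hk : 0 < k) (hs : 0 < s) (hst : s < t) (ht : t ≤ 2) :
    (√(t * k) - √(s * k)) * ((√(2 * Real.pi))⁻¹ * Real.exp (-(k * bsRate s))) ≤
      callBS k √(t * k) := by
  have hu : 0 < √(s * k) := Real.sqrt_pos.2 (by positivity)
  have huv : √(s * k) < √(t * k) := Real.sqrt_lt_sqrt (by positivity) (by gcongr)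
  obtain ⟨c, hc, he⟩ := exists_hasDerivAt_eq_slope (callBS k)
    (fun σ => gaussianPDFReal 0 1 (-k / σ + σ / 2)) huv
    ((continuousOn_callBS k).mono fun x hx => hu.trans_le hx.1)
    (fun x hx => hasDerivAt_callBS k (hu.trans hx.1).ne')
  have hc0 : 0 < c := hu.trans hc.1
  have hsub : 0 < √(t * k) - √(s * k) := sub_pos.2 huv
  have hc1 : s ≤ c ^ 2 / k := by
    rw [le_div_iff₀ hk, ← Real.sq_sqrt (show 0 ≤ s * k by positivity)]
    exact pow_le_pow_left₀ hu.le hc.1.le 2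
  have hc2 : c ^ 2 / k ≤ 2 := by
    refine le_trans ?_ ht
    rw [div_le_iff₀ hk, ← Real.sq_sqrt (show 0 ≤ t * k by nlinarith)]
    exact pow_le_pow_left₀ hc0.le hc.2.le 2
  have hpdf : (√(2 * Real.pi))⁻¹ * Real.exp (-(k * bsRate s)) ≤
      gaussianPDFReal 0 1 (-k / c + c / 2) := by
    rw [gaussianPDFReal_std, half_sq_bs_arg hk hc0]
    have := bsRate_anti hs hc1 hc2
    gcongr
  rw [he, le_div_iff₀ hsub] at hpdf
  have h0 := callBS_nonneg hk hu
  linarith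

/-- For large `k`, uniformly in `x ≥ ε`, the volatility matching the price `e^{-kx}` satisfies
`σ² / k ≤ (1 + η) ψ(x)`. -/
lemma eventually_callBS_vol_le {ε δ : ℝ} (hε : 0 < ε) (hδ : 0 < δ) :
    ∀ᶠ k : ℝ in atTop, ∀ x σ : ℝ, ε ≤ x → 0 < σ → callBS k σ = Real.exp (-(k * x)) →
      σ ^ 2 / k ≤ (1 + δ) * wingPsi x := by
  have hψ := wingPsi_pos hε.le
  have hψ2 := wingPsi_lt_two hε
  -- `η` is small enough that `(1 + η) ψ(x)` stays in `(0, 2]`, where the rate is monotone, for all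
  -- `x ≥ ε`; this is possible since `ψ(ε) < 2`.
  obtain ⟨η, hη, hηδ, hη2⟩ : ∃ η : ℝ, 0 < η ∧ η ≤ δ ∧ (1 + η) * wingPsi ε ≤ 2 := by
    refine ⟨min δ (2 / wingPsi ε - 1), lt_min hδ ?_, min_le_left _ _, ?_⟩
    · rw [sub_pos, lt_div_iff₀ hψ]; linarith
    · have := min_le_right δ (2 / wingPsi ε - 1)
      calc (1 + min δ (2 / wingPsi ε - 1)) * wingPsi ε ≤ (2 / wingPsi ε) * wingPsi ε := by
            gcongr; linarith
        _ = 2 := div_mul_cancel₀ _ hψ.ne'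
  -- The vega is integrated from variance `l ψ(x) k` to `(1 + η) ψ(x) k`; `c √k √ψ(x)` is the
  -- resulting prefactor.
  set l : ℝ := 1 + η / 2 with hl
  set c : ℝ := (√(1 + η) - √l) * (√(2 * Real.pi))⁻¹ with hc
  have hc0 : 0 < c := by
    have : √l < √(1 + η) := Real.sqrt_lt_sqrt (by positivity) (by linarith)
    have h2 := sub_pos.2 this
    positivity
  have hl1 : 0 < 1 - 1 / l := by
    rw [sub_pos, div_lt_one (by positivity)]; linarith
  have hk1 : ∀ᶠ k : ℝ in atTop, 1 ≤ c * √k :=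
    ((Real.tendsto_sqrt_atTop.const_mul_atTop hc0)).eventually_ge_atTop 1
  filter_upwards [hk1, eventually_gt_atTop 0, eventually_gt_atTop (1 / (1 - 1 / l))]
    with k hk1 hk hk2 x σ hx hσ h
  have hx0 : 0 < x := hε.trans_le hx
  have hp := wingPsi_pos hx0.le
  have hpε := wingPsi_antitone hε.le hx
  refine le_trans ?_ (mul_le_mul_of_nonneg_right (by linarith : 1 + η ≤ 1 + δ) hp.le)
  by_contra! hlt
  have ht2 : (1 + η) * wingPsi x ≤ 2 := le_trans (by gcongr) hη2
  have hst : l * wingPsi x < (1 + η) * wingPsi x := by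
    apply mul_lt_mul_of_pos_right _ hp; linarith
  have hlow := le_callBS hk (by positivity : 0 < l * wingPsi x) hst ht2
  have hmono : callBS k √((1 + η) * wingPsi x * k) ≤ callBS k σ := by
    apply monotoneOn_callBS k (Real.sqrt_pos.2 (by positivity)) hσ
    rw [Real.sqrt_le_left hσ.le]
    rw [lt_div_iff₀ hk] at hlt
    exact hlt.le
  have e : (√((1 + η) * wingPsi x * k) - √(l * wingPsi x * k)) *
      ((√(2 * Real.pi))⁻¹ * Real.exp (-(k * bsRate (l * wingPsi x)))) =
      c * √k * √(wingPsi x) * Real.exp (-(k * bsRate (l * wingPsi x))) := by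
    rw [mul_assoc (1 + η), mul_assoc l, Real.sqrt_mul (by positivity) (wingPsi x * k),
      Real.sqrt_mul (by positivity) (wingPsi x * k),      Real.sqrt_mul hp.le, hc]
    ring
  rw [e] at hlow
  have hrate : bsRate (l * wingPsi x) ≤ x / l := by
    have := bsRate_mul_le hp (by linarith : 1 ≤ l) (hst.le.trans ht2)
    rwa [bsRate_wingPsi hx0.le] at this
  -- The prefactor may vanish as `x` grows, but it costs at most `e^{-x}`, since `1 / ψ(x) ≤ 1 + 2x
  -- ≤ e^{2x}`. This is negligible against `e^{-kx}`, uniformly in `x`.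
  have hsq : Real.exp (-x) ≤ √(wingPsi x) := by
    apply Real.le_sqrt_of_sq_le
    rw [← Real.exp_nat_mul, ← inv_inv (wingPsi x), Nat.cast_ofNat, mul_neg, Real.exp_neg]
    apply inv_anti₀ (by positivity)
    refine (inv_wingPsi_le hx0.le).trans ?_
    linarith [Real.add_one_le_exp (2 * x)]
  have hfin : Real.exp (-x) * Real.exp (-(k * (x / l))) ≤ Real.exp (-(k * x)) := by
    rw [← h]
    refine le_trans ?_ (hlow.trans hmono)
    have h1 : 1 * √(wingPsi x) ≤ c * √k * √(wingPsi x) := by gcongr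
    have h2 : Real.exp (-x) ≤ c * √k * √(wingPsi x) := by linarith
    gcongr
  rw [← Real.exp_add, Real.exp_le_exp] at hfin
  have h3 : k * x * (1 - 1 / l) ≤ x := by
    have : k * (x / l) = k * x * (1 / l) := by ring
    linarith
  rw [div_lt_iff₀ hl1] at hk2
  nlinarith

/-! ### Asymptotic equivalence -/

lemma asympEq_of_eventually_bounds {g h : ℝ → ℝ}
    (H : ∀ ε : ℝ, 0 < ε → ε < 1 →
      ∀ᶠ k in atTop, 0 < h k ∧ (1 - ε) * h k ≤ g k ∧ g k ≤ (1 + ε) * h k) : AsympEq g h := by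
  refine Metric.tendsto_nhds.2 fun ε hε => ?_
  have h2 : 0 < min (ε / 2) (1 / 2) := by positivity
  filter_upwards [H _ h2 ((min_le_right _ _).trans_lt (by norm_num))] with k hk
  obtain ⟨hp, h1, h3⟩ := hk
  have hm := min_le_left (ε / 2) (1 / 2)
  rw [Real.dist_eq, abs_lt, lt_sub_iff_add_lt, sub_lt_iff_lt_add, lt_div_iff₀ hp, div_lt_iff₀ hp]
  constructor <;> nlinarith

lemma AsympEq.trans_of_ne {f g h : ℝ → ℝ} (hg : ∀ᶠ k in atTop, g k ≠ 0)
    (hfg : AsympEq f g) (hgh : AsympEq g h) : AsympEq f h := by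
  have := Tendsto.mul hfg hgh
  rw [one_mul] at this
  refine this.congr' ?_
  filter_upwards [hg] with k hk
  field_simp

lemma AsympEq.symm {f g : ℝ → ℝ} (h : AsympEq f g) : AsympEq g f := by
  have := Tendsto.inv₀ h one_ne_zero
  rw [inv_one] at this
  exact this.congr fun k => inv_div _ _

lemma AsympEq.congr_left {f f' g : ℝ → ℝ} (h : AsympEq f g) (hf : f =ᶠ[atTop] f') :
    AsympEq f' g :=
  Tendsto.congr' (by filter_upwards [hf] with k hk; rw [hk]) h

lemma AsympEq.congr_right {f g g' : ℝ → ℝ} (h : AsympEq f g) (hg : g =ᶠ[atTop] g') :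
    AsympEq f g' :=
  Tendsto.congr' (by filter_upwards [hg] with k hk; rw [hk]) h

/-- Asymptotic equivalence to the same function, divided by the argument. -/
lemma AsympEq.div_self_arg {f g : ℝ → ℝ} (h : AsympEq f g) :
    AsympEq (fun k => f k / k) (fun k => g k / k) := by
  refine Tendsto.congr' ?_ h
  filter_upwards [eventually_gt_atTop 0] with k hk
  rw [div_div_div_cancel_right₀ hk.ne']

lemma AsympEq.eventually_le {f g : ℝ → ℝ} (h : AsympEq f g) (hg : ∀ᶠ k in atTop, 0 < g k)
    {c : ℝ} (hc : c < 1) : ∀ᶠ k in atTop, c * g k ≤ f k := by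
  filter_upwards [hg, h.eventually (lt_mem_nhds hc)] with k hk h1
  exact ((lt_div_iff₀ hk).1 h1).le

lemma AsympEq.tendsto_atTop {f g : ℝ → ℝ} (h : AsympEq f g) (hg : Tendsto g atTop atTop) :
    Tendsto f atTop atTop := by
  refine tendsto_atTop_mono' _ (h.eventually_le (hg.eventually_gt_atTop 0)
    (by norm_num : (1 / 2 : ℝ) < 1)) (hg.const_mul_atTop (by norm_num))

/-! ### Regular variation -/

/-- The additive form of the uniform convergence theorem for slowly varying functions. -/
lemma eventually_abs_sub_le_of_tendsto_sub {κ : ℝ → ℝ} (hκ : Measurable κ)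
    (h : ∀ u, Tendsto (fun t => κ (t + u) - κ t) atTop (𝓝 0)) {ε : ℝ} (hε : 0 < ε) :
    ∀ᶠ t in atTop, ∀ u ∈ Icc (0 : ℝ) 1, |κ (t + u) - κ t| ≤ ε := by
  -- The bad shifts at `t`. Pointwise convergence gives convergence in measure on `[0, 2]` along
  -- sequences, so their measure there tends to 0.
  set A : ℝ → Set ℝ := fun t => {v | ENNReal.ofReal (ε / 2) ≤ edist (κ (t + v) - κ t) 0} with hA
  have hmeas : Tendsto (fun t => (volume.restrict (Icc (0 : ℝ) 2)) (A t)) atTop (𝓝 0) := by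
    refine tendsto_of_seq_tendsto fun s hs => ?_
    refine tendstoInMeasure_of_tendsto_ae (μ := volume.restrict (Icc (0 : ℝ) 2))
      (f := fun n v => κ (s n + v) - κ (s n)) (g := fun _ => 0) (fun n => ?_)
      (ae_of_all _ fun v => (h v).comp hs) (ENNReal.ofReal (ε / 2)) (by simpa using hε)
    exact ((hκ.comp (measurable_const_add _)).sub_const _).aestronglyMeasurable
  have hev := hmeas.eventually (gt_mem_nhds (show (0 : ENNReal) < 2⁻¹ by simp))
  obtain ⟨T, hT⟩ := eventually_atTop.1 hev
  filter_upwards [eventually_ge_atTop T] with t ht u hu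
  have h1 := hT t ht
  have h2 := hT (t + u) (by linarith [hu.1])
  -- Two bad sets of measure below 1/2, the second translated by `u`, cannot cover `[1, 2]`. A shift
  -- `v` good for both compares `κ t` and `κ (t + u)` through `κ (t + v)`.
  obtain ⟨v, hv, hv1, hv2⟩ : ∃ v ∈ Icc (1 : ℝ) 2, v ∉ A t ∧ v + -u ∉ A (t + u) := by
    by_contra! hcon
    have hsub : Icc (1 : ℝ) 2 ⊆
        (A t ∩ Icc 0 2) ∪ (fun v => v + -u) ⁻¹' (A (t + u) ∩ Icc 0 2) := by
      intro v hv
      by_cases hvA : v ∈ A t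
      · exact Or.inl ⟨hvA, by linarith [hv.1], hv.2⟩
      · exact Or.inr ⟨hcon v hv hvA, by linarith [hv.1, hu.2], by linarith [hv.2, hu.1]⟩
    have := (measure_mono hsub).trans (measure_union_le (μ := volume) _ _)
    rw [measure_preimage_add_right, Real.volume_Icc,
      ← Measure.restrict_apply' measurableSet_Icc, ← Measure.restrict_apply' measurableSet_Icc]
      at this
    have hlt := ENNReal.add_lt_add h1 h2
    rw [ENNReal.inv_two_add_inv_two] at hlt
    have h3 := this.trans_lt hlt
    norm_num at h3
  simp only [hA, mem_ofPred_eq, not_le, edist_dist,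
    ENNReal.ofReal_lt_ofReal_iff (half_pos hε), Real.dist_eq, sub_zero] at hv1 hv2
  have e : t + u + (v + -u) = t + v := by ring
  rw [e] at hv2
  rw [abs_lt] at hv1 hv2
  rw [abs_le]
  constructor <;> linarith

namespace RegVarying

variable {α : ℝ} {g : ℝ → ℝ}

lemma eventually_pos (h : RegVarying α g) : ∀ᶠ x in atTop, 0 < g x := by
  obtain ⟨a, ha, -⟩ := h.pos_measurable
  exact eventually_atTop.2 ⟨a, ha⟩

lemma exists_pos_measurable_ge (h : RegVarying α g) (b : ℝ) :
    ∃ a : ℝ, b ≤ a ∧ (∀ x, a ≤ x → 0 < g x) ∧ Measurable (fun x : Ici a => g x) := by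
  obtain ⟨a, ha, hm⟩ := h.pos_measurable
  refine ⟨max a b, le_max_right _ _, fun x hx => ha x ((le_max_left _ _).trans hx), ?_⟩
  exact hm.comp (measurable_inclusion (Ici_subset_Ici.2 (le_max_left a b)))

lemma tendsto_log_sub (h : RegVarying α g) (u : ℝ) :
    Tendsto (fun t => Real.log (g (Real.exp (t + u))) - Real.log (g (Real.exp t)) - α * u)
      atTop (𝓝 0) := by
  have h1 := ((Real.continuousAt_log (Real.rpow_pos_of_pos (Real.exp_pos u) α).ne').tendsto.comp
    (h.tendsto_ratio _ (Real.exp_pos u))).comp Real.tendsto_exp_atTop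
  have h2 := h1.sub_const (α * u)
  rw [Real.log_rpow (Real.exp_pos u), Real.log_exp, sub_self] at h2
  refine h2.congr' ?_
  have hp := Real.tendsto_exp_atTop.eventually h.eventually_pos
  have hp' := (tendsto_atTop_add_const_right _ u tendsto_id).eventually hp
  filter_upwards [hp, hp'] with t ht ht'
  simp only [id] at ht'
  simp only [Function.comp_apply]
  rw [show Real.exp u * Real.exp t = Real.exp (t + u) by rw [Real.exp_add, mul_comm],
    Real.log_div ht'.ne' ht.ne']

/-- The uniform convergence theorem for regularly varying functions, on `[1, 2]`. -/
lemma eventually_bounds (h : RegVarying α g) {ε : ℝ} (hε : 0 < ε) :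
    ∀ᶠ x in atTop, ∀ l ∈ Icc (1 : ℝ) 2,
      (1 - ε) * (l ^ α * g x) ≤ g (l * x) ∧ g (l * x) ≤ (1 + ε) * (l ^ α * g x) := by
  obtain ⟨a, ha1, hpos, hm⟩ := h.exists_pos_measurable_ge 1
  -- Extension by 1 off the half-line gives the global measurability required in the additive form.
  set G : ℝ → ℝ := Function.extend (Subtype.val : Ici a → ℝ) (fun x => g x) (fun _ => 1) with hG
  have hGm : Measurable G :=
    (MeasurableEmbedding.subtype_coe measurableSet_Ici).measurable_extend hm measurable_const
  have hGg : ∀ x, a ≤ x → G x = g x := fun x hx =>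
    Subtype.val_injective.extend_apply (fun x : Ici a => g x) (fun _ => 1) ⟨x, hx⟩
  set κ : ℝ → ℝ := fun t => Real.log (G (Real.exp t)) - α * t with hκ
  have hκm : Measurable κ :=
    (Real.measurable_log.comp (hGm.comp Real.measurable_exp)).sub (measurable_const_mul α)
  have hev : ∀ᶠ t in atTop, a ≤ Real.exp t := Real.tendsto_exp_atTop.eventually_ge_atTop a
  have hlim : ∀ u, Tendsto (fun t => κ (t + u) - κ t) atTop (𝓝 0) := by
    intro u
    refine (h.tendsto_log_sub u).congr' ?_
    have hev' := (tendsto_atTop_add_const_right _ u tendsto_id).eventually hev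
    filter_upwards [hev, hev'] with t ht ht'
    simp only [id] at ht'
    simp only [hκ]
    rw [hGg _ ht, hGg _ ht']
    ring
  have hδ : 0 < Real.log (1 + ε) := Real.log_pos (by linarith)
  have hunif := Real.tendsto_log_atTop.eventually (eventually_abs_sub_le_of_tendsto_sub hκm hlim hδ)
  filter_upwards [hunif, eventually_ge_atTop a] with x hx hxa l hl
  have hx0 : 0 < x := by linarith
  have hl0 : 0 < l := by linarith [hl.1]
  have hlx : a ≤ l * x := hxa.trans (le_mul_of_one_le_left hx0.le hl.1)
  have hgx := hpos x hxa
  have hglx := hpos _ hlx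
  have key := hx (Real.log l) ⟨Real.log_nonneg hl.1, by
    rw [← Real.log_exp 1]
    exact Real.log_le_log hl0 (by linarith [hl.2, Real.add_one_le_exp 1])⟩
  simp only [hκ] at key
  rw [Real.exp_add, Real.exp_log hx0, Real.exp_log hl0, mul_comm x l, hGg _ hxa, hGg _ hlx] at key
  have hrp := Real.rpow_pos_of_pos hl0 α
  have hll : Real.log (l ^ α * g x) = α * Real.log l + Real.log (g x) := by
    rw [Real.log_mul hrp.ne' hgx.ne', Real.log_rpow hl0]
  have hprod : 0 < l ^ α * g x := mul_pos hrp hgx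
  rw [abs_le] at key
  constructor
  · have : Real.log (l ^ α * g x) ≤ Real.log ((1 + ε) * g (l * x)) := by
      rw [hll, Real.log_mul (by positivity) hglx.ne']
      linarith
    have h2 := (Real.log_le_log_iff hprod (by positivity)).1 this
    rcases le_total 1 ε with h3 | h3
    · nlinarith
    · calc (1 - ε) * (l ^ α * g x) ≤ (1 - ε) * ((1 + ε) * g (l * x)) := by
            gcongr
        _ = (1 - ε ^ 2) * g (l * x) := by ring
        _ ≤ 1 * g (l * x) := by gcongr; nlinarith
        _ = g (l * x) := one_mul _
  · have : Real.log (g (l * x)) ≤ Real.log ((1 + ε) * (l ^ α * g x)) := by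
      rw [Real.log_mul (by positivity) hprod.ne', hll]
      linarith
    exact (Real.log_le_log_iff hglx (by positivity)).1 this

/-- Regularly varying functions of positive index are almost increasing. -/
lemma eventually_le_of_le (h : RegVarying α g) (hα : 0 < α) {ε : ℝ} (hε : 0 < ε) :
    ∀ᶠ x in atTop, ∀ y, x ≤ y → (1 - ε) * g x ≤ g y := by
  have h2 : 1 < (2 : ℝ) ^ α := Real.one_lt_rpow (by norm_num) hα
  -- With `(1 - η) 2^α ≥ 1` a doubling of the argument loses nothing, so the factor `1 - η` is paid
  -- once and not at each doubling.
  set η : ℝ := min ε (1 - 1 / 2 ^ α) with hη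
  have hη0 : 0 < η := by
    refine lt_min hε (sub_pos.2 ?_)
    rwa [div_lt_one (by positivity)]
  have hη1 : 1 ≤ (1 - η) * 2 ^ α := by
    have : 1 / 2 ^ α ≤ 1 - η := by linarith [min_le_right ε (1 - 1 / (2 : ℝ) ^ α)]
    rwa [div_le_iff₀ (by positivity)] at this
  have hη2 : 0 < 1 - η := by nlinarith
  obtain ⟨X, hX⟩ := eventually_atTop.1
    ((h.eventually_bounds hη0).and (h.eventually_pos.and (eventually_gt_atTop 0)))
  have claim : ∀ n : ℕ, ∀ x, X ≤ x → ∀ y, x ≤ y → y ≤ 2 ^ n * x → (1 - η) * g x ≤ g y := by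
    intro n
    induction n with
    | zero =>
      intro x hx y hxy hy
      obtain rfl : y = x := le_antisymm (by simpa using hy) hxy
      have := (hX y hx).2.1
      nlinarith
    | succ n ih =>
      intro x hx y hxy hy
      obtain ⟨hb, hg, hx0⟩ := hX x hx
      rcases le_total y (2 * x) with hy2 | hy2
      · have := (hb (y / x) ⟨by rwa [le_div_iff₀ hx0, one_mul], by rwa [div_le_iff₀ hx0]⟩).1
        rw [div_mul_cancel₀ _ hx0.ne'] at this
        refine le_trans ?_ this
        have h1 : 1 ≤ (y / x) ^ α :=
          Real.one_le_rpow (by rwa [le_div_iff₀ hx0, one_mul]) hα.le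
        gcongr
        nlinarith
      · have h3 := ih (2 * x) (by linarith) y hy2 (by rw [pow_succ] at hy; linarith)
        have h4 := (hb 2 ⟨by norm_num, le_rfl⟩).1
        refine le_trans ?_ h3
        gcongr
        nlinarith
  filter_upwards [eventually_ge_atTop X] with x hx y hxy
  obtain ⟨-, hg, hx0⟩ := hX x hx
  obtain ⟨n, hn⟩ := pow_unbounded_of_one_lt (y / x) (one_lt_two)
  refine le_trans ?_ (claim n x hx y hxy ((div_le_iff₀ hx0).1 hn.le))
  gcongr
  exact min_le_left _ _

lemma rpow_mul (h : RegVarying α g) (γ : ℝ) : RegVarying (α + γ) (fun x => x ^ γ * g x) := by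
  obtain ⟨a, ha, hpos, hm⟩ := h.exists_pos_measurable_ge 1
  refine ⟨⟨a, fun x hx => ?_, ?_⟩, fun l hl => ?_⟩
  · have := hpos x hx
    have h0 : 0 < x := by linarith
    positivity
  · exact (measurable_subtype_coe.pow_const γ).mul hm
  · rw [Real.rpow_add hl, mul_comm]
    refine ((h.tendsto_ratio l hl).const_mul (l ^ γ)).congr' ?_
    filter_upwards [eventually_gt_atTop 0] with x hx
    have := (Real.rpow_pos_of_pos hx γ).ne'
    rw [Real.mul_rpow hl.le hx.le]
    field_simp

lemma inv (h : RegVarying α g) : RegVarying (-α) (fun x => (g x)⁻¹) := by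
  obtain ⟨a, hpos, hm⟩ := h.pos_measurable
  refine ⟨⟨a, fun x hx => inv_pos.2 (hpos x hx), hm.inv⟩, fun l hl => ?_⟩
  rw [Real.rpow_neg hl.le]
  refine ((h.tendsto_ratio l hl).inv₀ (Real.rpow_pos_of_pos hl α).ne').congr fun x => ?_
  rw [inv_div_inv, inv_div]

/-- The function `x^(-α/2) g x` still has positive index, hence is almost increasing and bounded
below, so `g` outgrows a multiple of `x^(α/2)`. -/
lemma tendsto_atTop (h : RegVarying α g) (hα : 0 < α) : Tendsto g atTop atTop := by
  have h1 := h.rpow_mul (-(α / 2))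
  obtain ⟨x, hx, hx0, hp⟩ := ((h1.eventually_le_of_le (by linarith) one_half_pos).and
    ((eventually_gt_atTop 0).and h1.eventually_pos)).exists
  refine tendsto_atTop_mono' _ ?_ ((tendsto_rpow_atTop (half_pos hα)).const_mul_atTop
    (mul_pos (by norm_num : (0 : ℝ) < 1 - 1 / 2) hp))
  filter_upwards [eventually_ge_atTop x] with y hy
  have hy0 : 0 < y := hx0.trans_le hy
  have := hx y hy
  rwa [Real.rpow_neg hy0.le, inv_mul_eq_div, le_div_iff₀ (by positivity)] at this

lemma of_asympEq {f : ℝ → ℝ} (h : RegVarying α g) (hfg : AsympEq f g)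
    (hf : ∃ a : ℝ, (∀ x, a ≤ x → 0 < f x) ∧ Measurable (fun x : Ici a => f x)) :
    RegVarying α f := by
  refine ⟨hf, fun l hl => ?_⟩
  have hlx : Tendsto (fun x : ℝ => l * x) atTop atTop := tendsto_id.const_mul_atTop hl
  have := ((Tendsto.comp hfg hlx).mul (h.tendsto_ratio l hl)).mul (Tendsto.inv₀ hfg one_ne_zero)
  rw [one_mul, inv_one, mul_one] at this
  refine this.congr' ?_
  filter_upwards [h.eventually_pos, hlx.eventually h.eventually_pos] with x h1 h2
  simp only [Function.comp_apply]
  field_simp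

/-- A unit shift multiplies the argument by a factor tending to 1. The allowance `1 + ε` is split
evenly between the power `l ^ α` and the uniform error. -/
lemma eventually_le_of_mem_Icc (h : RegVarying α g) {ε : ℝ} (hε : 0 < ε) :
    ∀ᶠ x in atTop, ∀ y ∈ Icc x (x + 1), g y ≤ (1 + ε) * g x := by
  set r : ℝ := √(1 + ε) with hr
  have hr1 : 1 < r := by rw [hr, Real.lt_sqrt (by norm_num)]; linarith
  have hrr : r * r = 1 + ε := Real.mul_self_sqrt (by positivity)
  have hcont : ∀ᶠ l in 𝓝[≥] (1 : ℝ), l ^ α < r := by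
    have : ContinuousAt (fun l : ℝ => l ^ α) 1 := Real.continuousAt_rpow_const _ _ (Or.inl one_ne_zero)
    refine (this.eventually (gt_mem_nhds ?_)).filter_mono nhdsWithin_le_nhds
    simpa using hr1
  obtain ⟨b, hb, hbl⟩ := (mem_nhdsGE_iff_exists_Icc_subset).1 hcont
  have hb1 : 0 < b - 1 := sub_pos.2 hb
  filter_upwards [h.eventually_bounds (sub_pos.2 hr1), h.eventually_pos, eventually_ge_atTop 1,
    eventually_ge_atTop (1 / (b - 1))] with x hx hg hx1 hxb y hy
  have hx0 : 0 < x := by linarith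
  have hl1 : 1 ≤ y / x := by rw [le_div_iff₀ hx0, one_mul]; exact hy.1
  have hl2 : y / x ≤ 2 := by rw [div_le_iff₀ hx0]; linarith [hy.2]
  have hlb : y / x ≤ b := by
    rw [div_le_iff₀ hb1] at hxb
    rw [div_le_iff₀ hx0]
    linarith [hy.2]
  have h1 := (hx (y / x) ⟨hl1, hl2⟩).2
  have h2 : (y / x) ^ α < r := hbl ⟨hl1, hlb⟩
  rw [div_mul_cancel₀ _ hx0.ne'] at h1
  refine h1.trans ?_
  rw [← hrr, mul_assoc, add_sub_cancel]
  gcongr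

/-- Logarithmic asymptotics of the tail integral of `exp (-g)`: upper bound. -/
lemma eventually_lintegral_exp_neg_le (h : RegVarying α g) (hα : 0 < α) {ε : ℝ} (hε : 0 < ε)
    (hε1 : ε < 1) :
    ∀ᶠ k in atTop, ∫⁻ y in Ici k, ENNReal.ofReal (Real.exp (-g y)) ≤
      ENNReal.ofReal (Real.exp (-((1 - ε) * g k))) := by
  -- A share `ε / 2` of `g y` pays for the integrable factor `y⁻²`, whose integral over `[k, ∞)` is
  -- `1 / k ≤ 1`. The rest is at least `(1 - ε/2)² g k ≥ (1 - ε) g k`.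
  have hgrow : ∀ᶠ y in atTop, 2 * Real.log y ≤ ε / 2 * g y := by
    have h1 := ((h.rpow_mul (-(α / 2))).tendsto_atTop (by linarith)).eventually_ge_atTop 1
    have h2 := (isLittleO_log_rpow_atTop (half_pos hα)).bound (show 0 < ε / 4 by positivity)
    filter_upwards [h1, h2, eventually_ge_atTop 1] with y hy1 hy2 hy
    have hy0 : 0 < y := by linarith
    have hp := Real.rpow_pos_of_pos hy0 (α / 2)
    rw [Real.rpow_neg hy0.le, inv_mul_eq_div, le_div_iff₀ hp, one_mul] at hy1
    rw [Real.norm_of_nonneg (Real.log_nonneg hy), Real.norm_of_nonneg hp.le] at hy2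
    nlinarith
  obtain ⟨Y, hY⟩ := eventually_atTop.1 hgrow
  filter_upwards [h.eventually_le_of_le hα (half_pos hε), h.eventually_pos, eventually_ge_atTop Y,
    eventually_ge_atTop 1] with k hk hg hkY hk1
  have hk0 : 0 < k := by linarith
  have hpt : ∀ y ∈ Ici k, ENNReal.ofReal (Real.exp (-g y)) ≤
      ENNReal.ofReal (Real.exp (-((1 - ε) * g k))) * ENNReal.ofReal (y ^ (-2 : ℝ)) := by
    intro y hy
    have hy0 : 0 < y := hk0.trans_le hy
    rw [← ENNReal.ofReal_mul (Real.exp_pos _).le, Real.rpow_def_of_pos hy0, ← Real.exp_add]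
    apply ENNReal.ofReal_le_ofReal
    rw [Real.exp_le_exp]
    have h1 := hk y hy
    have h2 := hY y (hkY.trans hy)
    have h3 := mul_le_mul_of_nonneg_left h1 (by linarith : 0 ≤ 1 - ε / 2)
    have h4 : 0 ≤ (ε / 2) ^ 2 * g k := by positivity
    linarith
  refine (setLIntegral_mono' measurableSet_Ici hpt).trans ?_
  rw [lintegral_const_mul' _ _ ENNReal.ofReal_ne_top]
  refine mul_le_of_le_one_right' ?_
  rw [setLIntegral_congr Ioi_ae_eq_Ici.symm, ← ofReal_integral_eq_lintegral_ofReal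
    (integrableOn_Ioi_rpow_of_lt (by norm_num) hk0)
    ((ae_restrict_iff' measurableSet_Ioi).2 (ae_of_all _ fun y hy =>
      Real.rpow_nonneg (hk0.le.trans (le_of_lt hy)) _)),
    integral_Ioi_rpow_of_lt (by norm_num) hk0]
  rw [ENNReal.ofReal_le_one]
  have : k ^ (-2 + 1 : ℝ) ≤ 1 := Real.rpow_le_one_of_one_le_of_nonpos hk1 (by norm_num)
  norm_num at this ⊢
  exact this

/-- Logarithmic asymptotics of the tail integral of `exp (-g)`: lower bound. -/
lemma eventually_le_lintegral_exp_neg (h : RegVarying α g) {ε : ℝ} (hε : 0 < ε) :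
    ∀ᶠ k in atTop, ENNReal.ofReal (Real.exp (-((1 + ε) * g k))) ≤
      ∫⁻ y in Ici k, ENNReal.ofReal (Real.exp (-g y)) := by
  filter_upwards [h.eventually_le_of_mem_Icc hε] with k hk
  calc ENNReal.ofReal (Real.exp (-((1 + ε) * g k)))
      = ∫⁻ _ in Icc k (k + 1), ENNReal.ofReal (Real.exp (-((1 + ε) * g k))) := by
        simp
    _ ≤ ∫⁻ y in Icc k (k + 1), ENNReal.ofReal (Real.exp (-g y)) := by
        refine setLIntegral_mono' measurableSet_Icc fun y hy => ?_
        apply ENNReal.ofReal_le_ofReal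
        rw [Real.exp_le_exp]
        exact neg_le_neg (hk y hy)
    _ ≤ _ := lintegral_mono_set Icc_subset_Ici_self

end RegVarying

/-! ### Asymptotics of `ψ` -/

/-- As `ψ` decreases and `x ψ(x)` increases, `ψ(x) / ψ(y)` lies between 1 and `y / x`. No
boundedness of the arguments is needed. -/
lemma asympEq_wingPsi {x y : ℝ → ℝ} (hx : ∀ᶠ k in atTop, 0 < x k) (hy : ∀ᶠ k in atTop, 0 < y k)
    (h : AsympEq x y) : AsympEq (fun k => wingPsi (x k)) (fun k => wingPsi (y k)) := by
  have h1 : Tendsto (fun k => min 1 (y k / x k)) atTop (𝓝 1) := by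
    simpa using (tendsto_const_nhds (x := (1 : ℝ))).min h.symm
  have h2 : Tendsto (fun k => max 1 (y k / x k)) atTop (𝓝 1) := by
    simpa using (tendsto_const_nhds (x := (1 : ℝ))).max h.symm
  refine tendsto_of_tendsto_of_tendsto_of_le_of_le' h1 h2 ?_ ?_
  all_goals
    filter_upwards [hx, hy] with k hxk hyk
    have px := wingPsi_pos hxk.le
    have py := wingPsi_pos hyk.le
    rcases le_total (x k) (y k) with hle | hle
    · have a := wingPsi_antitone hxk.le hle
      have b := mul_wingPsi_le hxk hle
      first
      | refine (min_le_left _ _).trans ?_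
        rwa [le_div_iff₀ py, one_mul]
      | refine le_trans ?_ (le_max_right _ _)
        rw [div_le_div_iff₀ py hxk]
        linarith
    · have a := wingPsi_antitone hyk.le hle
      have b := mul_wingPsi_le hyk hle
      first
      | refine (min_le_right _ _).trans ?_
        rw [div_le_div_iff₀ hxk py]
        linarith
      | refine le_trans ?_ (le_max_left _ _)
        rwa [div_le_one py]

lemma tendsto_two_mul_self_mul_wingPsi :
    Tendsto (fun x => 2 * x * wingPsi x) atTop (𝓝 1) := by
  have h1 : Tendsto (fun x : ℝ => 1 - x⁻¹) atTop (𝓝 1) := by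
    simpa using tendsto_inv_atTop_zero.const_sub (1 : ℝ)
  refine tendsto_of_tendsto_of_tendsto_of_le_of_le' h1 tendsto_const_nhds ?_ ?_
  all_goals
    filter_upwards [eventually_gt_atTop 0] with x hx
    have h2 := sqrt_sq_add_self_le hx.le
    have h3 : x ≤ √(x ^ 2 + x) := Real.le_sqrt_of_sq_le (by linarith)
    rw [wingPsi_eq hx.le, mul_div_assoc']
  · rw [le_div_iff₀ (by positivity)]
    have h4 : x⁻¹ * x = 1 := inv_mul_cancel₀ hx.ne'
    have h5 : 0 < x⁻¹ := by positivity
    rcases le_total x⁻¹ 1 with h | h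
    · have : (1 - x⁻¹) * (1 + 2 * x + 2 * √(x ^ 2 + x)) ≤ (1 - x⁻¹) * (2 + 4 * x) := by
        apply mul_le_mul_of_nonneg_left <;> linarith
      nlinarith
    · have : (1 - x⁻¹) * (1 + 2 * x + 2 * √(x ^ 2 + x)) ≤ 0 :=
        mul_nonpos_of_nonpos_of_nonneg (by linarith) (by positivity)
      linarith
  · rw [div_le_one (by positivity)]
    linarith

lemma asympEq_wingPsi_of_tendsto {x y : ℝ → ℝ} (hx : Tendsto x atTop atTop) (h : AsympEq x y) :
    AsympEq (fun k => wingPsi (x k)) (fun k => 1 / (2 * y k)) := by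
  have := (tendsto_two_mul_self_mul_wingPsi.comp hx).mul h.symm
  rw [one_mul] at this
  refine this.congr' ?_
  filter_upwards [hx.eventually_gt_atTop 0] with k hk
  simp only [Function.comp_apply]
  field_simp

/-! ### Adding the identity to a regularly varying function -/

namespace RegVarying

variable {α : ℝ} {g : ℝ → ℝ}

lemma of_asympEq_measurable {f : ℝ → ℝ} (h : RegVarying α g) (hfg : AsympEq f g)
    (hf : Measurable f) : RegVarying α f := by
  obtain ⟨a, ha⟩ := eventually_atTop.1 (h.eventually_pos.and
    (hfg.eventually_le h.eventually_pos (by norm_num : (1 / 2 : ℝ) < 1)))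
  refine h.of_asympEq hfg ⟨a, fun x hx => ?_, hf.comp measurable_subtype_coe⟩
  have := ha x hx
  linarith

/-- The linear lower bound excludes `α < 1`. For `α = 1` both summands have index 1, and for `α > 1`
the identity is negligible. -/
lemma id_add (h : RegVarying α g) {ε : ℝ} (hε : 0 < ε) (hlin : ∀ᶠ k in atTop, ε * k ≤ g k) :
    RegVarying α (fun k => k + g k) := by
  obtain ⟨a, ha, hpos, hm⟩ := h.exists_pos_measurable_ge 0
  have hpm : ∃ a : ℝ, (∀ x, a ≤ x → 0 < x + g x) ∧ Measurable (fun x : Ici a => (x : ℝ) + g x) :=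
    ⟨a, fun x hx => by linarith [hpos x hx], measurable_subtype_coe.add hm⟩
  rcases lt_trichotomy α 1 with hα | rfl | hα
  · exfalso
    have h1 := (h.inv.rpow_mul 1).tendsto_atTop (by linarith)
    obtain ⟨k, hk1, hk2, hk3, hk4⟩ := ((h1.eventually_gt_atTop (1 / ε)).and
      (hlin.and (h.eventually_pos.and (eventually_gt_atTop 0)))).exists
    rw [Real.rpow_one, ← div_eq_mul_inv, div_lt_div_iff₀ hε hk3] at hk1
    linarith
  · refine ⟨hpm, fun l hl => ?_⟩
    rw [Real.rpow_one, tendsto_iff_dist_tendsto_zero]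
    have h1 := tendsto_iff_dist_tendsto_zero.1 (h.tendsto_ratio l hl)
    rw [Real.rpow_one] at h1
    refine squeeze_zero' (Eventually.of_forall fun _ => dist_nonneg) ?_ h1
    filter_upwards [h.eventually_pos, eventually_gt_atTop 0] with k hg hk
    have e1 : (l * k + g (l * k)) / (k + g k) - l = (g (l * k) - l * g k) / (k + g k) := by
      field_simp; ring
    have e2 : g (l * k) / g k - l = (g (l * k) - l * g k) / g k := by
      field_simp
    rw [Real.dist_eq, Real.dist_eq, e1, e2, abs_div, abs_div, abs_of_pos hg,
      abs_of_pos (add_pos hk hg)]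
    gcongr
    linarith
  · refine h.of_asympEq ?_ hpm
    have h1 := ((h.rpow_mul (-1)).tendsto_atTop (by linarith)).inv_tendsto_atTop.add_const 1
    rw [zero_add] at h1
    refine h1.congr' ?_
    filter_upwards [h.eventually_pos, eventually_gt_atTop 0] with k hg hk
    rw [Pi.inv_apply, Real.rpow_neg_one]
    field_simp

end RegVarying

/-! ### Put prices, call prices and the distribution function -/

section Market

variable {Ω : Type*} [MeasurableSpace Ω] {P : Measure Ω} {X : Ω → ℝ}

lemma monotone_distFn : Monotone (distFn P X) := monotone_cdf _

lemma distFn_nonneg (x : ℝ) : 0 ≤ distFn P X x := cdf_nonneg _ x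

lemma tendsto_distFn_neg : Tendsto (fun k => distFn P X (-k)) atTop (𝓝 0) :=
  (tendsto_cdf_atBot _).comp tendsto_neg_atTop_atBot

lemma integrable_exp_map (hX : AEMeasurable X P) (hint : Integrable (fun ω => Real.exp (X ω)) P) :
    Integrable Real.exp (P.map X) :=
  (integrable_map_measure Real.continuous_exp.aestronglyMeasurable hX).2 hint

lemma IsDensity.eventually_pos {f : ℝ → ℝ} (hf : IsDensity P X f)
    (h : ∀ᶠ k in atTop, 0 < -Real.log (f (-k))) : ∀ᶠ k in atTop, 0 < f (-k) := by
  filter_upwards [h] with k hk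
  -- `Real.log 0 = 0`, so a positive `-log` excludes the value 0.
  refine (hf.nonneg _).lt_of_ne' fun h0 => ?_
  simp [h0] at hk

variable [IsProbabilityMeasure P]

lemma distFn_eq_real (hX : AEMeasurable X P) (x : ℝ) : distFn P X x = (P.map X).real (Iic x) :=
  have := Measure.isProbabilityMeasure_map hX
  cdf_eq_real _ x

lemma distFn_le_exp (hX : AEMeasurable X P) {ε : ℝ} (hε : 0 < ε)
    (h : Integrable (fun ω => Real.exp (-ε * X ω)) P) (k : ℝ) :
    distFn P X (-k) ≤ Real.exp (-(ε * k)) * mgf X P (-ε) := by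
  have h1 := measure_le_le_exp_mul_mgf (-k) (neg_nonpos.2 hε.le) h
  rw [distFn_eq_real hX, measureReal_def, Measure.map_apply_of_aemeasurable hX measurableSet_Iic]
  refine h1.trans_eq ?_
  congr 2
  ring

lemma integrable_exp_sub_exp (hX : AEMeasurable X P)
    (hint : Integrable (fun ω => Real.exp (X ω)) P) (k : ℝ) :
    Integrable (fun x => Real.exp k - Real.exp x) (P.map X) :=
  have := Measure.isProbabilityMeasure_map hX
  (integrable_const _).sub (integrable_exp_map hX hint)

/-- Put-call parity: the payoff `e^k - e^x` integrates to `e^k - 1` over the whole line. -/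
lemma callPrice_eq (hX : AEMeasurable X P) (hint : Integrable (fun ω => Real.exp (X ω)) P)
    (hRN : ∫ ω, Real.exp (X ω) ∂P = 1) (k : ℝ) :
    callPrice P X k = 1 - Real.exp k + putPrice P X k := by
  have := Measure.isProbabilityMeasure_map hX
  have hi := integrable_exp_sub_exp hX hint k
  have h1 : ∫ x, (Real.exp k - Real.exp x) ∂(P.map X) = Real.exp k - 1 := by
    rw [integral_sub (integrable_const _) (integrable_exp_map hX hint),
      integral_map hX Real.continuous_exp.aestronglyMeasurable, hRN]
    simp
  have h2 := setIntegral_union (μ := P.map X) (Iio_disjoint_Ici (le_refl k)) measurableSet_Ici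
    hi.integrableOn hi.integrableOn
  rw [Iio_union_Ici, setIntegral_univ, h1] at h2
  have h3 : ∫ x in Ici k, (Real.exp k - Real.exp x) ∂(P.map X) = -callPrice P X k := by
    rw [callPrice, ← integral_neg]
    simp only [neg_sub]
    refine (setIntegral_eq_of_subset_of_forall_sdiff_eq_zero measurableSet_Ici Ioi_subset_Ici_self
      fun x hx => ?_)
    obtain rfl : x = k := le_antisymm (not_lt.1 hx.2) hx.1
    exact sub_self _
  rw [h3] at h2
  unfold putPrice
  linarith

lemma monotone_putPrice (hX : AEMeasurable X P) (hint : Integrable (fun ω => Real.exp (X ω)) P) :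
    Monotone (putPrice P X) := by
  intro k l hkl
  have := Measure.isProbabilityMeasure_map hX
  calc putPrice P X k ≤ ∫ x in Iio k, (Real.exp l - Real.exp x) ∂(P.map X) :=
        setIntegral_mono (integrable_exp_sub_exp hX hint k).integrableOn
          (integrable_exp_sub_exp hX hint l).integrableOn fun x =>
            sub_le_sub_right (Real.exp_le_exp.2 hkl) _
    _ ≤ putPrice P X l := by
        refine setIntegral_mono_set (integrable_exp_sub_exp hX hint l).integrableOn ?_
          (Iio_subset_Iio hkl).eventuallyLE
        exact (ae_restrict_iff' measurableSet_Iio).2 (ae_of_all _ fun x hx =>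
          sub_nonneg.2 (Real.exp_le_exp.2 (le_of_lt hx)))

lemma putPrice_le (hX : AEMeasurable X P) (hint : Integrable (fun ω => Real.exp (X ω)) P) (k : ℝ) :
    putPrice P X k ≤ Real.exp k * distFn P X k := by
  have := Measure.isProbabilityMeasure_map hX
  calc putPrice P X k ≤ ∫ _ in Iio k, Real.exp k ∂(P.map X) :=
        setIntegral_mono (integrable_exp_sub_exp hX hint k).integrableOn
          (integrable_const _).integrableOn fun x => sub_le_self _ (Real.exp_pos x).le
    _ = (P.map X).real (Iio k) * Real.exp k := by simp
    _ ≤ Real.exp k * distFn P X k := by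
        rw [distFn_eq_real hX, mul_comm]
        exact mul_le_mul_of_nonneg_left (measureReal_mono Iio_subset_Iic_self) (Real.exp_pos k).le

/-- Only outcomes at least one unit below the strike are kept; there the payoff is at least `e^k (1
- e^{-1})`. -/
lemma le_putPrice (hX : AEMeasurable X P) (hint : Integrable (fun ω => Real.exp (X ω)) P) (k : ℝ) :
    Real.exp k * (1 - Real.exp (-1)) * distFn P X (k - 1) ≤ putPrice P X k := by
  have := Measure.isProbabilityMeasure_map hX
  calc Real.exp k * (1 - Real.exp (-1)) * distFn P X (k - 1)
      = ∫ _ in Iic (k - 1), (Real.exp k - Real.exp (k - 1)) ∂(P.map X) := by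
        rw [setIntegral_const, distFn_eq_real hX, smul_eq_mul, sub_eq_add_neg k 1, Real.exp_add]
        ring
    _ ≤ ∫ x in Iic (k - 1), (Real.exp k - Real.exp x) ∂(P.map X) :=
        setIntegral_mono_on (integrable_const _).integrableOn
          (integrable_exp_sub_exp hX hint k).integrableOn measurableSet_Iic fun x hx =>
            sub_le_sub_left (Real.exp_le_exp.2 hx) _
    _ ≤ putPrice P X k := by
        refine setIntegral_mono_set (integrable_exp_sub_exp hX hint k).integrableOn ?_
          (Iic_subset_Iio.2 (by linarith)).eventuallyLE
        exact (ae_restrict_iff' measurableSet_Iio).2 (ae_of_all _ fun x hx =>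
          sub_nonneg.2 (Real.exp_le_exp.2 (le_of_lt hx)))

lemma putPrice_nonneg (hX : AEMeasurable X P) (hint : Integrable (fun ω => Real.exp (X ω)) P)
    (k : ℝ) : 0 ≤ putPrice P X k := by
  refine le_trans ?_ (le_putPrice hX hint k)
  have := distFn_nonneg (P := P) (X := X) (k - 1)
  have h1 : Real.exp (-1) ≤ 1 := Real.exp_le_one_iff.2 (by norm_num)
  have h2 := sub_nonneg.2 h1
  positivity

lemma putPrice_pos (hX : AEMeasurable X P) (hint : Integrable (fun ω => Real.exp (X ω)) P)
    {k : ℝ} (h : 0 < distFn P X (k - 1)) : 0 < putPrice P X k := by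
  refine lt_of_lt_of_le ?_ (le_putPrice hX hint k)
  have h1 : Real.exp (-1) < 1 := Real.exp_lt_one_iff.2 (by norm_num)
  have h2 := sub_pos.2 h1
  positivity

lemma eventually_putPrice_pos_of_distFn (hX : AEMeasurable X P)
    (hint : Integrable (fun ω => Real.exp (X ω)) P) (h : ∀ᶠ k in atTop, 0 < distFn P X (-k)) :
    ∀ᶠ k in atTop, 0 < putPrice P X (-k) := by
  filter_upwards [(tendsto_atTop_add_const_right _ (1 : ℝ) tendsto_id).eventually h] with k hk
  apply putPrice_pos hX hint
  rwa [← neg_add']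

/-! ### The implied volatility -/

/-- The intrinsic value cancels on both sides, leaving a price at log-strike `k` that lies in `(0,
1)` because `p(-k) ≤ e^{-k} F(-k)`. Uniqueness of `σ` plays no role: the volatility bounds hold for
every solution. -/
lemma impliedVol_neg_spec (hX : AEMeasurable X P) (hint : Integrable (fun ω => Real.exp (X ω)) P)
    (hRN : ∫ ω, Real.exp (X ω) ∂P = 1) {k : ℝ} (hk : 0 < k) (hp : 0 < putPrice P X (-k))
    (hF : distFn P X (-k) < 1) :
    0 < impliedVol P X (-k) ∧
      callBS k (impliedVol P X (-k)) = Real.exp k * putPrice P X (-k) := by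
  have hek : Real.exp (-k) * Real.exp k = 1 := by rw [← Real.exp_add]; simp
  have hq1 : Real.exp k * putPrice P X (-k) < 1 := by
    calc Real.exp k * putPrice P X (-k) ≤ Real.exp k * (Real.exp (-k) * distFn P X (-k)) := by
          gcongr
          exact putPrice_le hX hint (-k)
      _ = distFn P X (-k) := by linear_combination distFn P X (-k) * hek
      _ < 1 := hF
  have hiff : ∀ σ, callBS (-k) σ = callPrice P X (-k) ↔
      callBS k σ = Real.exp k * putPrice P X (-k) := by
    intro σ
    rw [callBS_neg, callPrice_eq hX hint hRN, add_right_inj]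
    constructor
    · intro h
      linear_combination Real.exp k * h - callBS k σ * hek
    · intro h
      linear_combination Real.exp (-k) * h + putPrice P X (-k) * hek
  have hex : ∃ σ : ℝ, 0 < σ ∧ callBS (-k) σ = callPrice P X (-k) := by
    obtain ⟨σ, hσ, h⟩ := exists_callBS_eq hk (mul_pos (Real.exp_pos k) hp) hq1
    exact ⟨σ, hσ, (hiff σ).2 h⟩
  have hspec := hex.choose_spec
  rw [hiff] at hspec
  have e : impliedVol P X (-k) = hex.choose := dif_pos hex
  rw [e]
  exact hspec

/-- A lower bound for the exponential rate of decay of the distribution function. -/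
lemma exists_eventually_le_neg_log_distFn (hX : AEMeasurable X P)
    (hIL : ∃ ε : ℝ, 0 < ε ∧ Integrable (fun ω => Real.exp (-ε * X ω)) P) :
    ∃ ε : ℝ, 0 < ε ∧ ∀ᶠ k in atTop, distFn P X (-k) ≤ Real.exp (-(ε * k)) := by
  obtain ⟨ε, hε, h⟩ := hIL
  -- Half of the exponent absorbs the constant `mgf X P (-ε)`.
  refine ⟨ε / 2, half_pos hε, ?_⟩
  have hlim : Tendsto (fun k : ℝ => Real.exp (ε / 2 * k)) atTop atTop :=
    Real.tendsto_exp_atTop.comp (tendsto_id.const_mul_atTop (half_pos hε))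
  filter_upwards [hlim.eventually_ge_atTop (mgf X P (-ε))] with k hk
  calc distFn P X (-k) ≤ Real.exp (-(ε * k)) * mgf X P (-ε) := distFn_le_exp hX hε h k
    _ ≤ Real.exp (-(ε * k)) * Real.exp (ε / 2 * k) := by gcongr
    _ = Real.exp (-(ε / 2 * k)) := by rw [← Real.exp_add]; congr 1; ring

/-- Keeps the rate away from 0, where `ψ` reaches 2 and the uniform upper bound on the volatility is
not available. -/
lemma exists_eventually_le_putRate (hX : AEMeasurable X P)
    (hint : Integrable (fun ω => Real.exp (X ω)) P)
    (hIL : ∃ ε : ℝ, 0 < ε ∧ Integrable (fun ω => Real.exp (-ε * X ω)) P)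
    (hp : ∀ᶠ k in atTop, 0 < putPrice P X (-k)) :
    ∃ ε : ℝ, 0 < ε ∧ ∀ᶠ k in atTop, ε ≤ -1 - Real.log (putPrice P X (-k)) / k := by
  obtain ⟨ε, hε, h⟩ := exists_eventually_le_neg_log_distFn hX hIL
  refine ⟨ε, hε, ?_⟩
  filter_upwards [h, hp, eventually_gt_atTop 0] with k hk hpk hk0
  have h1 : putPrice P X (-k) ≤ Real.exp (-((1 + ε) * k)) := by
    calc putPrice P X (-k) ≤ Real.exp (-k) * distFn P X (-k) := putPrice_le hX hint _
      _ ≤ Real.exp (-k) * Real.exp (-(ε * k)) := by gcongr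
      _ = _ := by rw [← Real.exp_add]; congr 1; ring
  have h2 := (Real.log_le_iff_le_exp hpk).2 h1
  have h3 : Real.log (putPrice P X (-k)) / k ≤ -(1 + ε) := by
    rw [div_le_iff₀ hk0]; linarith
  linarith

/-- The tail-wing formula in terms of the put price. -/
lemma asympEq_impliedVol_wingPsi (hX : AEMeasurable X P)
    (hint : Integrable (fun ω => Real.exp (X ω)) P) (hRN : ∫ ω, Real.exp (X ω) ∂P = 1)
    (hIL : ∃ ε : ℝ, 0 < ε ∧ Integrable (fun ω => Real.exp (-ε * X ω)) P)
    (hp : ∀ᶠ k in atTop, 0 < putPrice P X (-k)) :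
    AsympEq (fun k => impliedVol P X (-k) ^ 2 / k)
      (fun k => wingPsi (-1 - Real.log (putPrice P X (-k)) / k)) := by
  obtain ⟨ε, hε, hrate⟩ := exists_eventually_le_putRate hX hint hIL hp
  have hF : ∀ᶠ k in atTop, distFn P X (-k) < 1 :=
    tendsto_distFn_neg.eventually (gt_mem_nhds one_pos)
  refine asympEq_of_eventually_bounds fun δ hδ _ => ?_
  filter_upwards [hrate, hp, hF, eventually_gt_atTop 0, eventually_callBS_vol_le hε hδ]
    with k hr hpk hFk hk hup
  obtain ⟨hV, heq⟩ := impliedVol_neg_spec hX hint hRN hk hpk hFk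
  set x := -1 - Real.log (putPrice P X (-k)) / k with hx
  have hx0 : 0 < x := hε.trans_le hr
  have hexp : Real.exp k * putPrice P X (-k) = Real.exp (-(k * x)) := by
    conv_lhs => rw [← Real.exp_log hpk, ← Real.exp_add]
    congr 1
    rw [hx]
    field_simp
    ring
  rw [hexp] at heq
  have hψ := wingPsi_pos hx0.le
  refine ⟨hψ, ?_, hup x _ hr hV heq⟩
  refine le_trans ?_ (wingPsi_le_of_callBS_eq hk hV hx0.le heq)
  nlinarith

/-! ### Relations between the density, the distribution function and the put price -/

lemma asympEq_neg_log_putPrice (hX : AEMeasurable X P)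
    (hint : Integrable (fun ω => Real.exp (X ω)) P) {α : ℝ}
    (h : RegVarying α (fun k => -Real.log (distFn P X (-k)))) :
    AsympEq (fun k => -Real.log (putPrice P X (-k))) (fun k => k - Real.log (distFn P X (-k))) := by
  -- The constant from `le_putPrice`; eventually `C ≤ ε k`, so it disappears in the relative error
  -- of `k`.
  set C : ℝ := -Real.log (1 - Real.exp (-1)) with hC
  have hc : 0 < 1 - Real.exp (-1) := sub_pos.2 (Real.exp_lt_one_iff.2 (by norm_num))
  have hpos : ∀ᶠ k in atTop, 0 < distFn P X (-k) := by
    filter_upwards [h.eventually_pos] with k hk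
    refine (distFn_nonneg _).lt_of_ne' fun h0 => ?_
    simp [h0] at hk
  have hpos1 := (tendsto_atTop_add_const_right _ (1 : ℝ) tendsto_id).eventually hpos
  refine asympEq_of_eventually_bounds fun ε hε _ => ?_
  filter_upwards [h.eventually_pos, h.eventually_le_of_mem_Icc hε, hpos, hpos1,
    eventually_gt_atTop 0, (tendsto_id.const_mul_atTop hε).eventually_ge_atTop C]
    with k hg hg1 hF hF1 hk hkC
  simp only [id] at hF1 hkC
  have hp : 0 < putPrice P X (-k) := putPrice_pos hX hint (by rwa [← neg_add'])
  have hup : Real.log (putPrice P X (-k)) ≤ -k + Real.log (distFn P X (-k)) := by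
    have := Real.log_le_log hp (putPrice_le hX hint (-k))
    rwa [Real.log_mul (Real.exp_pos _).ne' hF.ne', Real.log_exp] at this
  have hlow : -k - C + Real.log (distFn P X (-(k + 1))) ≤ Real.log (putPrice P X (-k)) := by
    have h1 := le_putPrice hX hint (-k)
    rw [← neg_add'] at h1
    have := Real.log_le_log (by positivity) h1
    rw [Real.log_mul (by positivity) hF1.ne', Real.log_mul (Real.exp_pos _).ne' hc.ne',
      Real.log_exp] at this
    linarith
  have h2 := hg1 (k + 1) ⟨by linarith, le_rfl⟩
  refine ⟨by linarith, ?_, ?_⟩ <;> nlinarith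

lemma ofReal_distFn_neg_eq (hX : AEMeasurable X P) {f : ℝ → ℝ} (hf : IsDensity P X f) (k : ℝ) :
    ENNReal.ofReal (distFn P X (-k)) = ∫⁻ y in Ici k, ENNReal.ofReal (f (-y)) := by
  have := Measure.isProbabilityMeasure_map hX
  rw [distFn, ofReal_cdf, hf.map_eq, withDensity_apply _ measurableSet_Iic]
  have h := (Measure.measurePreserving_neg (volume : Measure ℝ)).setLIntegral_comp_preimage
    (s := Iic (-k)) measurableSet_Iic hf.measurable.ennreal_ofReal
  rw [← h]
  congr 2
  ext y
  simp

lemma asympEq_neg_log_distFn (hX : AEMeasurable X P) {f : ℝ → ℝ} (hf : IsDensity P X f) {α : ℝ}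
    (hα : 0 < α) (h : RegVarying α (fun k => -Real.log (f (-k)))) :
    AsympEq (fun k => -Real.log (distFn P X (-k))) (fun k => -Real.log (f (-k))) := by
  have hfp := hf.eventually_pos h.eventually_pos
  obtain ⟨K, hK⟩ := eventually_atTop.1 hfp
  refine asympEq_of_eventually_bounds fun ε hε hε1 => ?_
  filter_upwards [h.eventually_pos, h.eventually_lintegral_exp_neg_le hα hε hε1,
    h.eventually_le_lintegral_exp_neg hε, eventually_ge_atTop K] with k hg hup hlow hk
  have e : ∫⁻ y in Ici k, ENNReal.ofReal (Real.exp (-(-Real.log (f (-y))))) =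
      ENNReal.ofReal (distFn P X (-k)) := by
    rw [ofReal_distFn_neg_eq hX hf]
    refine setLIntegral_congr_fun measurableSet_Ici fun y hy => ?_
    simp only [neg_neg]
    rw [Real.exp_log (hK y (hk.trans hy))]
  rw [e] at hup hlow
  rw [ENNReal.ofReal_le_ofReal_iff (Real.exp_pos _).le] at hup
  rw [ENNReal.ofReal_le_ofReal_iff (distFn_nonneg _)] at hlow
  have hF : 0 < distFn P X (-k) := (Real.exp_pos _).trans_le hlow
  have h1 := (Real.log_le_iff_le_exp hF).2 hup
  have h2 := (Real.le_log_iff_exp_le hF).2 hlow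
  refine ⟨hg, by linarith, by linarith⟩

/-- Regular variation is not needed: `f(-y) ≤ e^{-My}` integrates to `F(-k) ≤ e^{-Mk} / M`. -/
lemma tendsto_neg_log_distFn_div (hX : AEMeasurable X P) {f : ℝ → ℝ} (hf : IsDensity P X f)
    (h : Tendsto (fun k => -Real.log (f (-k)) / k) atTop atTop) :
    Tendsto (fun k => -Real.log (distFn P X (-k)) / k) atTop atTop := by
  have hfp : ∀ᶠ k in atTop, 0 < f (-k) := by
    apply hf.eventually_pos
    filter_upwards [h.eventually_gt_atTop 0, eventually_gt_atTop 0] with k hk hk0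
    exact (div_pos_iff_of_pos_right hk0).1 hk
  refine tendsto_atTop.2 fun b => ?_
  -- `M ≥ 1` allows the factor `1 / M` to be dropped.
  set M : ℝ := max b 1 with hM
  have hM0 : 0 < M := lt_of_lt_of_le one_pos (le_max_right _ _)
  obtain ⟨K, hK⟩ := eventually_atTop.1
    (hfp.and ((h.eventually_ge_atTop M).and (eventually_gt_atTop 0)))
  filter_upwards [eventually_ge_atTop K] with k hk
  obtain ⟨-, -, hk0⟩ := hK k hk
  have hup : ENNReal.ofReal (distFn P X (-k)) ≤ ENNReal.ofReal (Real.exp (-(M * k))) := by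
    rw [ofReal_distFn_neg_eq hX hf]
    have h1 : ∀ y ∈ Ici k, ENNReal.ofReal (f (-y)) ≤ ENNReal.ofReal (Real.exp (-M * y)) := by
      intro y hy
      obtain ⟨hy1, hy2, hy0⟩ := hK y (hk.trans hy)
      apply ENNReal.ofReal_le_ofReal
      rw [le_div_iff₀ hy0] at hy2
      rw [← Real.log_le_iff_le_exp hy1]
      linarith
    refine (setLIntegral_mono' measurableSet_Ici h1).trans ?_
    rw [setLIntegral_congr Ioi_ae_eq_Ici.symm, ← ofReal_integral_eq_lintegral_ofReal
      (integrableOn_exp_mul_Ioi (neg_lt_zero.2 hM0) k) (ae_of_all _ fun y => (Real.exp_pos _).le),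
      integral_exp_mul_Ioi (neg_lt_zero.2 hM0)]
    apply ENNReal.ofReal_le_ofReal
    rw [neg_div_neg_eq, ← neg_mul]
    exact div_le_self (Real.exp_pos _).le (le_max_right _ _)
  have hpos : 0 < distFn P X (-k) := by
    rw [← ENNReal.ofReal_pos, ofReal_distFn_neg_eq hX hf,
      setLIntegral_pos_iff (f := fun y => ENNReal.ofReal (f (-y)))
        (hf.measurable.comp measurable_neg).ennreal_ofReal]
    have hsub : Ici k ⊆ Function.support (fun y => ENNReal.ofReal (f (-y))) := fun y hy => by
      simpa using (hK y (hk.trans hy)).1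
    rw [inter_eq_self_of_subset_right hsub, Real.volume_Ici]
    exact ENNReal.zero_lt_top
  rw [ENNReal.ofReal_le_ofReal_iff (Real.exp_pos _).le, ← Real.log_le_iff_le_exp hpos] at hup
  rw [le_div_iff₀ hk0]
  have : b * k ≤ M * k := mul_le_mul_of_nonneg_right (le_max_left _ _) hk0.le
  linarith

end Market

/-! ### The left-tail-wing formula -/

lemma asympEq_sub_one {x : ℝ → ℝ} (hx : Tendsto x atTop atTop) :
    AsympEq (fun k => x k - 1) x := by
  have h := (tendsto_inv_atTop_zero.comp hx).const_sub (1 : ℝ)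
  rw [sub_zero] at h
  refine h.congr' ?_
  filter_upwards [hx.eventually_gt_atTop 0] with k hk
  simp only [Function.comp_apply]
  field_simp

/-- Subtracting 1 could spoil the relative error, but `y ≥ ε` gives `1 + y ≤ y (1 + ε) / ε`. -/
lemma asympEq_sub_one_of_asympEq_one_add {x y : ℝ → ℝ} {ε : ℝ} (hε : 0 < ε)
    (hy : ∀ᶠ k in atTop, ε ≤ y k) (h : AsympEq x (fun k => 1 + y k)) :
    AsympEq (fun k => x k - 1) y := by
  refine asympEq_of_eventually_bounds fun δ hδ _ => ?_
  have hδ' : 0 < δ * ε / (1 + ε) := by positivity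
  filter_upwards [hy, (Metric.tendsto_nhds.1 h) _ hδ'] with k hk hd
  have hy0 : 0 < 1 + y k := by linarith
  rw [Real.dist_eq, div_sub_one hy0.ne', abs_div, abs_of_pos hy0, div_lt_iff₀ hy0] at hd
  have h1 : δ * ε / (1 + ε) * (1 + y k) ≤ δ * y k := by
    rw [div_mul_eq_mul_div, div_le_iff₀ (by positivity)]
    nlinarith
  have h2 := abs_le.1 (hd.le.trans h1)
  refine ⟨by linarith, by linarith [h2.1], by linarith [h2.2]⟩

section Market

variable {Ω : Type*} [MeasurableSpace Ω] {P : Measure Ω} {X : Ω → ℝ}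

lemma eventually_distFn_pos (h : ∀ᶠ k in atTop, 0 < -Real.log (distFn P X (-k))) :
    ∀ᶠ k in atTop, 0 < distFn P X (-k) := by
  filter_upwards [h] with k hk
  refine (distFn_nonneg _).lt_of_ne' fun h0 => ?_
  simp [h0] at hk

lemma asympEq_putRate_self
    (h : Tendsto (fun k => -Real.log (putPrice P X (-k)) / k) atTop atTop) :
    AsympEq (fun k => -1 - Real.log (putPrice P X (-k)) / k)
      (fun k => -Real.log (putPrice P X (-k)) / k) :=
  (asympEq_sub_one h).congr_left (Eventually.of_forall fun k => by ring)

variable [IsProbabilityMeasure P]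

lemma eventually_putPrice_pos (hX : AEMeasurable X P)
    (hint : Integrable (fun ω => Real.exp (X ω)) P)
    (h : ∀ᶠ k in atTop, 0 < -Real.log (putPrice P X (-k))) :
    ∀ᶠ k in atTop, 0 < putPrice P X (-k) := by
  filter_upwards [h] with k hk
  refine (putPrice_nonneg hX hint _).lt_of_ne' fun h0 => ?_
  simp [h0] at hk

lemma asympEq_putRate (hX : AEMeasurable X P) (hint : Integrable (fun ω => Real.exp (X ω)) P)
    (hIL : ∃ ε : ℝ, 0 < ε ∧ Integrable (fun ω => Real.exp (-ε * X ω)) P) {α : ℝ}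
    (h : RegVarying α (fun k => -Real.log (distFn P X (-k)))) :
    AsympEq (fun k => -1 - Real.log (putPrice P X (-k)) / k)
      (fun k => -Real.log (distFn P X (-k)) / k) := by
  obtain ⟨ε, hε, hrate⟩ := exists_eventually_le_neg_log_distFn hX hIL
  have hy : ∀ᶠ k in atTop, ε ≤ -Real.log (distFn P X (-k)) / k := by
    filter_upwards [hrate, eventually_distFn_pos h.eventually_pos, eventually_gt_atTop 0]
      with k hk hF hk0
    rw [le_div_iff₀ hk0]
    linarith [(Real.log_le_iff_le_exp hF).2 hk]
  refine (asympEq_sub_one_of_asympEq_one_add hε hy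
    ((asympEq_neg_log_putPrice hX hint h).div_self_arg.congr_right ?_)).congr_left ?_
  · filter_upwards [eventually_gt_atTop 0] with k hk
    field_simp
    ring
  · exact Eventually.of_forall fun k => by ring

lemma asympEq_impliedVol_of_asympEq (hX : AEMeasurable X P)
    (hint : Integrable (fun ω => Real.exp (X ω)) P) (hRN : ∫ ω, Real.exp (X ω) ∂P = 1)
    (hIL : ∃ ε : ℝ, 0 < ε ∧ Integrable (fun ω => Real.exp (-ε * X ω)) P)
    (hp : ∀ᶠ k in atTop, 0 < putPrice P X (-k)) {y : ℝ → ℝ} (hy : ∀ᶠ k in atTop, 0 < y k)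
    (h : AsympEq (fun k => -1 - Real.log (putPrice P X (-k)) / k) y) :
    AsympEq (fun k => impliedVol P X (-k) ^ 2 / k) (fun k => wingPsi (y k)) := by
  obtain ⟨ε, hε, hrate⟩ := exists_eventually_le_putRate hX hint hIL hp
  have hx : ∀ᶠ k in atTop, 0 < -1 - Real.log (putPrice P X (-k)) / k :=
    hrate.mono fun k hk => hε.trans_le hk
  refine (asympEq_impliedVol_wingPsi hX hint hRN hIL hp).trans_of_ne ?_ (asympEq_wingPsi hx hy h)
  exact hx.mono fun k hk => (wingPsi_pos hk.le).ne'

lemma asympEq_impliedVol_of_tendsto (hX : AEMeasurable X P)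
    (hint : Integrable (fun ω => Real.exp (X ω)) P) (hRN : ∫ ω, Real.exp (X ω) ∂P = 1)
    (hIL : ∃ ε : ℝ, 0 < ε ∧ Integrable (fun ω => Real.exp (-ε * X ω)) P)
    (hp : ∀ᶠ k in atTop, 0 < putPrice P X (-k)) {z : ℝ → ℝ}
    (hz : Tendsto (fun k => -Real.log (z k) / k) atTop atTop)
    (h : AsympEq (fun k => -1 - Real.log (putPrice P X (-k)) / k)
      (fun k => -Real.log (z k) / k)) :
    AsympEq (fun k => impliedVol P X (-k) ^ 2 / k) (fun k => 1 / (-2 * Real.log (z k) / k)) := by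
  have hx := h.tendsto_atTop hz
  refine (((asympEq_impliedVol_wingPsi hX hint hRN hIL hp).trans_of_ne ?_
    (asympEq_wingPsi_of_tendsto hx h))).congr_right (Eventually.of_forall fun k => ?_)
  · exact (hx.eventually_gt_atTop 0).mono fun k hk => (wingPsi_pos hk.le).ne'
  · simp only [mul_div_assoc', mul_neg, neg_mul]

lemma eventually_putPrice_pos_of_tendsto (hX : AEMeasurable X P)
    (hint : Integrable (fun ω => Real.exp (X ω)) P)
    (h : Tendsto (fun k => -Real.log (putPrice P X (-k)) / k) atTop atTop) :
    ∀ᶠ k in atTop, 0 < putPrice P X (-k) := by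
  apply eventually_putPrice_pos hX hint
  filter_upwards [h.eventually_gt_atTop 0, eventually_gt_atTop 0] with k hk hk0
  exact (div_pos_iff_of_pos_right hk0).1 hk

lemma asympEq_impliedVol_putPrice (hX : AEMeasurable X P)
    (hint : Integrable (fun ω => Real.exp (X ω)) P) (hRN : ∫ ω, Real.exp (X ω) ∂P = 1)
    (hIL : ∃ ε : ℝ, 0 < ε ∧ Integrable (fun ω => Real.exp (-ε * X ω)) P)
    (h : Tendsto (fun k => -Real.log (putPrice P X (-k)) / k) atTop atTop) :
    AsympEq (fun k => impliedVol P X (-k) ^ 2 / k)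
      (fun k => 1 / (-2 * Real.log (putPrice P X (-k)) / k)) :=
  asympEq_impliedVol_of_tendsto hX hint hRN hIL (eventually_putPrice_pos_of_tendsto hX hint h) h
    (asympEq_putRate_self h)

lemma tendsto_impliedVol_zero (hX : AEMeasurable X P)
    (hint : Integrable (fun ω => Real.exp (X ω)) P) (hRN : ∫ ω, Real.exp (X ω) ∂P = 1)
    (hIL : ∃ ε : ℝ, 0 < ε ∧ Integrable (fun ω => Real.exp (-ε * X ω)) P)
    (h : Tendsto (fun k => -Real.log (putPrice P X (-k)) / k) atTop atTop) :
    Tendsto (fun k => impliedVol P X (-k) ^ 2 / k) atTop (𝓝 0) := by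
  have h1 := (tendsto_inv_atTop_zero.comp (h.const_mul_atTop two_pos))
  have h2 := (asympEq_impliedVol_putPrice hX hint hRN hIL h).mul h1
  rw [one_mul] at h2
  refine h2.congr' ?_
  filter_upwards [h.eventually_gt_atTop 0] with k hk
  have e : -2 * Real.log (putPrice P X (-k)) / k =
      2 * (-Real.log (putPrice P X (-k)) / k) := by ring
  simp only [Function.comp_apply, e]
  rw [one_div, div_mul_cancel₀]
  positivity

/-- The one-sided bound `p(-k) ≤ e^{-k} F(-k)` suffices, without regular variation. -/
lemma tendsto_neg_log_putPrice_div (hX : AEMeasurable X P)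
    (hint : Integrable (fun ω => Real.exp (X ω)) P)
    (h : Tendsto (fun k => -Real.log (distFn P X (-k)) / k) atTop atTop) :
    Tendsto (fun k => -Real.log (putPrice P X (-k)) / k) atTop atTop := by
  have hF : ∀ᶠ k in atTop, 0 < distFn P X (-k) := by
    apply eventually_distFn_pos
    filter_upwards [h.eventually_gt_atTop 0, eventually_gt_atTop 0] with k hk hk0
    exact (div_pos_iff_of_pos_right hk0).1 hk
  refine tendsto_atTop_mono' _ ?_ h
  filter_upwards [hF, eventually_putPrice_pos_of_distFn hX hint hF, eventually_gt_atTop 0]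
    with k hFk hp hk
  have h1 := Real.log_le_log hp (putPrice_le hX hint (-k))
  rw [Real.log_mul (Real.exp_pos _).ne' hFk.ne', Real.log_exp] at h1
  exact div_le_div_of_nonneg_right (by linarith) hk.le

lemma regVarying_distFn_of_density (hX : AEMeasurable X P) {f : ℝ → ℝ} (hf : IsDensity P X f)
    {α : ℝ} (hα : 0 < α) (h : RegVarying α (fun k => -Real.log (f (-k)))) :
    RegVarying α (fun k => -Real.log (distFn P X (-k))) :=
  h.of_asympEq_measurable (asympEq_neg_log_distFn hX hf hα h)
    (Real.measurable_log.comp (monotone_distFn.measurable.comp measurable_neg)).neg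

lemma regVarying_putPrice (hX : AEMeasurable X P) (hint : Integrable (fun ω => Real.exp (X ω)) P)
    (hIL : ∃ ε : ℝ, 0 < ε ∧ Integrable (fun ω => Real.exp (-ε * X ω)) P) {α : ℝ}
    (h : RegVarying α (fun k => -Real.log (distFn P X (-k)))) :
    RegVarying α (fun k => -Real.log (putPrice P X (-k))) := by
  obtain ⟨ε, hε, hrate⟩ := exists_eventually_le_neg_log_distFn hX hIL
  have hlin : ∀ᶠ k in atTop, ε * k ≤ -Real.log (distFn P X (-k)) := by
    filter_upwards [hrate, eventually_distFn_pos h.eventually_pos] with k hk hF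
    linarith [(Real.log_le_iff_le_exp hF).2 hk]
  refine (h.id_add hε hlin).of_asympEq_measurable (asympEq_neg_log_putPrice hX hint h)
    (Real.measurable_log.comp ((monotone_putPrice hX hint).measurable.comp measurable_neg)).neg

end Market

theorem theorem2 {Ω : Type*} [MeasurableSpace Ω] (P : Measure Ω) [IsProbabilityMeasure P]
    (X : Ω → ℝ) (hX : AEMeasurable X P)
    -- `X` is a risk-neutral return: `E[e^X] = 1`
    (hint : Integrable (fun ω => Real.exp (X ω)) P)
    (hRN : ∫ ω, Real.exp (X ω) ∂P = 1)
    (α : ℝ) (hα : 0 < α)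
    (hIL : ∃ ε : ℝ, 0 < ε ∧ Integrable (fun ω => Real.exp (-ε * X ω)) P) :
    -- (i) implies (ii)
    (∀ f : ℝ → ℝ, IsDensity P X f →
      RegVarying α (fun k => -Real.log (f (-k))) →
      RegVarying α (fun k => -Real.log (distFn P X (-k)))) ∧
    -- (ii) implies (iii)
    (RegVarying α (fun k => -Real.log (distFn P X (-k))) →
      RegVarying α (fun k => -Real.log (putPrice P X (-k)))) ∧
    -- (iii) implies (iv)
    (RegVarying α (fun k => -Real.log (putPrice P X (-k))) →
      AsympEq (fun k => impliedVol P X (-k) ^ 2 / k)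
        (fun k => wingPsi (-1 - Real.log (putPrice P X (-k)) / k))) ∧
    -- consequences of (ii), with (iv')
    (RegVarying α (fun k => -Real.log (distFn P X (-k))) →
      AsympEq (fun k => -Real.log (putPrice P X (-k)))
        (fun k => k - Real.log (distFn P X (-k))) ∧
      AsympEq (fun k => impliedVol P X (-k) ^ 2 / k)
        (fun k => wingPsi (-Real.log (distFn P X (-k)) / k))) ∧
    -- consequences of (i), with (iv'')
    (∀ f : ℝ → ℝ, IsDensity P X f →
      RegVarying α (fun k => -Real.log (f (-k))) →
      AsympEq (fun k => -Real.log (f (-k))) (fun k => -Real.log (distFn P X (-k))) ∧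
      AsympEq (fun k => impliedVol P X (-k) ^ 2 / k)
        (fun k => wingPsi (-Real.log (f (-k)) / k))) ∧
    -- sublinear behaviour
    (Tendsto (fun k => -Real.log (putPrice P X (-k)) / k) atTop atTop →
      Tendsto (fun k => impliedVol P X (-k) ^ 2 / k) atTop (𝓝 0)) ∧
    (Tendsto (fun k => -Real.log (distFn P X (-k)) / k) atTop atTop →
      Tendsto (fun k => impliedVol P X (-k) ^ 2 / k) atTop (𝓝 0)) ∧
    (∀ f : ℝ → ℝ, IsDensity P X f →
      Tendsto (fun k => -Real.log (f (-k)) / k) atTop atTop →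
      Tendsto (fun k => impliedVol P X (-k) ^ 2 / k) atTop (𝓝 0)) ∧
    -- (v) in terms of the put price
    (Tendsto (fun k => -Real.log (putPrice P X (-k)) / k) atTop atTop →
      AsympEq (fun k => impliedVol P X (-k) ^ 2 / k)
        (fun k => 1 / (-2 * Real.log (putPrice P X (-k)) / k))) ∧
    -- (v) under (ii)
    (RegVarying α (fun k => -Real.log (distFn P X (-k))) →
      (Tendsto (fun k => -Real.log (distFn P X (-k)) / k) atTop atTop ∨
        Tendsto (fun k => -Real.log (putPrice P X (-k)) / k) atTop atTop) →
      AsympEq (fun k => impliedVol P X (-k) ^ 2 / k)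
        (fun k => 1 / (-2 * Real.log (distFn P X (-k)) / k)) ∧
      AsympEq (fun k => impliedVol P X (-k) ^ 2 / k)
        (fun k => 1 / (-2 * Real.log (putPrice P X (-k)) / k))) ∧
    -- (v) under (i)
    (∀ f : ℝ → ℝ, IsDensity P X f →
      RegVarying α (fun k => -Real.log (f (-k))) →
      (Tendsto (fun k => -Real.log (f (-k)) / k) atTop atTop ∨
        Tendsto (fun k => -Real.log (distFn P X (-k)) / k) atTop atTop ∨
        Tendsto (fun k => -Real.log (putPrice P X (-k)) / k) atTop atTop) →
      AsympEq (fun k => impliedVol P X (-k) ^ 2 / k)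
        (fun k => 1 / (-2 * Real.log (f (-k)) / k)) ∧
      AsympEq (fun k => impliedVol P X (-k) ^ 2 / k)
        (fun k => 1 / (-2 * Real.log (distFn P X (-k)) / k)) ∧
      AsympEq (fun k => impliedVol P X (-k) ^ 2 / k)
        (fun k => 1 / (-2 * Real.log (putPrice P X (-k)) / k))) := by
  have putPos : RegVarying α (fun k => -Real.log (distFn P X (-k))) →
      ∀ᶠ k in atTop, 0 < putPrice P X (-k) := fun h =>
    eventually_putPrice_pos_of_distFn hX hint (eventually_distFn_pos h.eventually_pos)
  have ratePos : ∀ {g : ℝ → ℝ}, RegVarying α g → ∀ᶠ k in atTop, 0 < g k / k := fun h => by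
    filter_upwards [h.eventually_pos, eventually_gt_atTop 0] with k hk hk0
    exact div_pos hk hk0
  have rateF : ∀ f : ℝ → ℝ, IsDensity P X f → RegVarying α (fun k => -Real.log (f (-k))) →
      AsympEq (fun k => -1 - Real.log (putPrice P X (-k)) / k)
        (fun k => -Real.log (f (-k)) / k) := fun f hf h =>
    have hd := regVarying_distFn_of_density hX hf hα h
    (asympEq_putRate hX hint hIL hd).trans_of_ne ((ratePos hd).mono fun _ hk => hk.ne')
      (asympEq_neg_log_distFn hX hf hα h).div_self_arg
  -- The converse of `tendsto_neg_log_putPrice_div`; here regular variation is used, through the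
  -- equivalence of the two rates.
  have tendsDist : RegVarying α (fun k => -Real.log (distFn P X (-k))) →
      Tendsto (fun k => -Real.log (putPrice P X (-k)) / k) atTop atTop →
      Tendsto (fun k => -Real.log (distFn P X (-k)) / k) atTop atTop := fun h hp =>
    (asympEq_putRate hX hint hIL h).symm.tendsto_atTop ((asympEq_putRate_self hp).tendsto_atTop hp)
  have dist : RegVarying α (fun k => -Real.log (distFn P X (-k))) →
      Tendsto (fun k => -Real.log (distFn P X (-k)) / k) atTop atTop →
      AsympEq (fun k => impliedVol P X (-k) ^ 2 / k)
        (fun k => 1 / (-2 * Real.log (distFn P X (-k)) / k)) ∧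
      AsympEq (fun k => impliedVol P X (-k) ^ 2 / k)
        (fun k => 1 / (-2 * Real.log (putPrice P X (-k)) / k)) := fun h hF =>
    ⟨asympEq_impliedVol_of_tendsto hX hint hRN hIL (putPos h) hF (asympEq_putRate hX hint hIL h),
      asympEq_impliedVol_putPrice hX hint hRN hIL (tendsto_neg_log_putPrice_div hX hint hF)⟩
  refine ⟨fun f hf h => regVarying_distFn_of_density hX hf hα h,
    regVarying_putPrice hX hint hIL,
    fun h => asympEq_impliedVol_wingPsi hX hint hRN hIL
      (eventually_putPrice_pos hX hint h.eventually_pos),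
    fun h => ⟨asympEq_neg_log_putPrice hX hint h, asympEq_impliedVol_of_asympEq hX hint hRN hIL
      (putPos h) (ratePos h) (asympEq_putRate hX hint hIL h)⟩,
    fun f hf h => ⟨(asympEq_neg_log_distFn hX hf hα h).symm, asympEq_impliedVol_of_asympEq hX hint
      hRN hIL (putPos (regVarying_distFn_of_density hX hf hα h)) (ratePos h) (rateF f hf h)⟩,
    tendsto_impliedVol_zero hX hint hRN hIL,
    fun h => tendsto_impliedVol_zero hX hint hRN hIL (tendsto_neg_log_putPrice_div hX hint h),
    fun f hf h => tendsto_impliedVol_zero hX hint hRN hIL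
      (tendsto_neg_log_putPrice_div hX hint (tendsto_neg_log_distFn_div hX hf h)),
    asympEq_impliedVol_putPrice hX hint hRN hIL,
    fun h hor => dist h (hor.elim id (tendsDist h)), fun f hf h hor => ?_⟩
  have hd := regVarying_distFn_of_density hX hf hα h
  have hF : Tendsto (fun k => -Real.log (distFn P X (-k)) / k) atTop atTop := by
    rcases hor with h1 | h1 | h1
    · exact tendsto_neg_log_distFn_div hX hf h1
    · exact h1
    · exact tendsDist hd h1
  have hf' := (asympEq_neg_log_distFn hX hf hα h).div_self_arg.symm.tendsto_atTop hF
  exact ⟨asympEq_impliedVol_of_tendsto hX hint hRN hIL (putPos hd) hf' (rateF f hf h), dist hd hF⟩
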